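/- **Model ($B_{cd}L_{cd}$).** A network is a finite simple graph $G=(V,E)$ with $n=|V|$ nodes and maximum degree $\Delta$. All nodes start together and run the same local randomised algorithm, each with its own independent randomness and with no input (no identifiers, no knowledge of $n$, of $\Delta$ or of any degree). In each slot every node that has not terminated either beeps or listens. A beeping node learns whether at least one of its neighbours beeps in the same slot; a listening node learns whether zero, exactly one, or at least two of its neighbours beep. A node may terminate by choosing a colour in $\mathbb N$; it is then silent forever. The running time $T_G$ is the number of slots until all nodes have terminated. An algorithm is a *Las Vegas colouring algorithm on $G$* if, on $G$, with probability $1$ it holds that $T_G<\infty$ and neighbours never receive the same colour; it is a *Las Vegas colouring algorithm* if this holds on every network $G$. Write $\log$ for the binary logarithm; "with high probability" means with probability at least $1-\varepsilon(n)$, where $\varepsilon(n)=o(n^{-1})$. **Theorem (Las Vegas colouring takes $\Theta(\Delta+\log n)$ slots in $B_{cd}L_{cd}$).** 1. (Upper bound) There are a Las Vegas colouring algorithm, which in no execution gives two neighbours the same colour, a constant $C$ and a function $\varepsilon(n)=o(n^{-1})$ such that on every network $G$ with $n$ nodes and maximum degree $\Delta$, $$\Pr\big[T_G\le C(\Delta+\log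 n)\big]\ \ge\ 1-\varepsilon(n).$$ 2. (Lower bound) There are a constant $c>0$ and a function $\varepsilon(n)=o(n^{-1})$ such that for all integers $1\le\Delta<n$ there is a network $G$ with $n$ nodes and maximum degree $\Delta$ on which every Las Vegas colouring algorithm satisfies $$\Pr\big[T_G\le c(\Delta+\log n)\big]\ \le\ \varepsilon(n).$$ 3. (Complete graphs) For every algorithm that is a Las Vegas colouring algorithm on all complete graphs, and every $n$, $T_{K_n}\ge n$ with probability $1$. 4. (Rings) There are a constant $c>0$ and a function $\varepsilon(n)=o(n^{-1})$ such that for every $n$ and every algorithm that is a Las Vegas colouring algorithm on the ring $C_n$, $\Pr\big[T_{C_n}\le c\log n\big]\le\varepsilon(n)$. -/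

import Mathlib

open MeasureTheory Filter Asymptotics

namespace Beeping

/-- What a node does at the beginning of a slot: it beeps, it listens, or it has terminated
with a colour. -/
inductive Action
  | beep
  | listen
  | halt (colour : ℕ)

/-- What an active node perceives in one slot when collision detection is available both while
beeping and while listening. A beeping node learns whether some neighbour beeped too; a listening
node distinguishes between no beep, exactly one beep and at least two beeps. -/
inductive Percept
  | beepedAlone
  | beepedWithOthers
  | silence
  | oneBeep
  | severalBeeps

/-- The percept of a node, given whether it beeps itself and how many neighbours beep. -/
def perceive : Bool → ℕ → Percept
  | true, 0 => Percept.beepedAlone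
  | true, _ + 1 => Percept.beepedWithOthers
  | false, 0 => Percept.silence
  | false, 1 => Percept.oneBeep
  | false, _ + 2 => Percept.severalBeeps

/-- A local randomised algorithm for the beeping model with both kinds of collision detection.
A node draws its private randomness `r` from the probability space `(Seed, law)`; its action in a
slot is a function of `r` and of the list of what it has perceived so far (latest percept first).
It receives no other input: no identifier, no degree, no information on the network. -/
structure Algorithm where
  Seed : Type
  [measurableSpace : MeasurableSpace Seed]
  law : Measure Seed
  [isProbabilityMeasure : IsProbabilityMeasure law]
  act : Seed → List Percept → Action
  measurableSet_act : ∀ (h : List Percept) (a : Action), MeasurableSet {r : Seed | act r h = a}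

attribute [instance] Algorithm.measurableSpace Algorithm.isProbabilityMeasure

namespace Algorithm

variable (A : Algorithm) {V : Type} (G : SimpleGraph V) (ω : V → A.Seed)

/-- The local history of every node after one more slot. All nodes run the same algorithm, and
`h v` is the history of `v` before the slot. A terminated node is passive: it neither beeps nor
perceives anything. -/
noncomputable def step (h : V → List Percept) (v : V) : List Percept :=
  let beepingNeighbours : ℕ := {u : V | G.Adj v u ∧ A.act (ω u) (h u) = Action.beep}.ncard
  match A.act (ω v) (h v) with
  | Action.beep => perceive true beepingNeighbours :: h v
  | Action.listen => perceive false beepingNeighbours :: h v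
  | Action.halt _ => h v

/-- The local histories after `t` slots, when all nodes start together with an empty history and
`ω v` is the private randomness of `v`. -/
noncomputable def history : ℕ → V → List Percept
  | 0 => fun _ => []
  | t + 1 => A.step G ω (history t)

/-- After `t` slots, the node `v` has terminated with colour `c`. -/
def HasColour (t : ℕ) (v : V) (c : ℕ) : Prop :=
  A.act (ω v) (A.history G ω t v) = Action.halt c

/-- All nodes have terminated within `t` slots. -/
def TerminatedBy (t : ℕ) : Prop :=
  ∀ v, ∃ c, A.HasColour G ω t v c

/-- In the execution, no two neighbours ever terminate with the same colour. -/
def IsProper : Prop :=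
  ∀ u v, G.Adj u v → ∀ t c, ¬ (A.HasColour G ω t u c ∧ A.HasColour G ω t v c)

/-- The law of the private randomness of all nodes: independent copies of the seed. -/
noncomputable def seeds (V : Type) [Fintype V] : Measure (V → A.Seed) :=
  Measure.pi fun _ : V => A.law

/-- `A` is a Las Vegas colouring algorithm on the network `G`: with probability one, all nodes
terminate after finitely many slots, and their colours form a proper colouring. -/
def IsLasVegasColouringOn [Fintype V] : Prop :=
  ∀ᵐ ω ∂(A.seeds V), (∃ t, A.TerminatedBy G ω t) ∧ A.IsProper G ω

/-- `A` is a Las Vegas colouring algorithm: it is one on every finite network. -/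
def IsLasVegasColouring : Prop :=
  ∀ (V : Type) [Fintype V] (G : SimpleGraph V), A.IsLasVegasColouringOn G

/-- The probability that, on the network `G`, all nodes have terminated within at most `x`
slots. -/
noncomputable def probWithin [Fintype V] (x : ℝ) : ℝ :=
  (A.seeds V).real {ω | ∃ t : ℕ, (t : ℝ) ≤ x ∧ A.TerminatedBy G ω t}

end Algorithm

end Beeping

/-! Lower bounds. Almost sure properness extends to all choices of typical seeds, those whose
behaviour up to any time has positive probability (`isProper_of_typical`). Hence a seed may be
copied from one node to another, and symmetry then forces neighbours to share a colour.

For the term `Δ`: suppose adjacency is transitive and `v` never beeps alone. A closed twin of `v`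
with the same seed goes unnoticed, so both receive the same colour. Thus every node has to beep
alone, and the members of a clique do so in different slots (`card_le_of_terminatedBy`).

For the term `log n`: let an involutive automorphism `σ` exchange the ends of an edge `v`, `σ v`.
Next to its own mirror image, `v` can never terminate. Run each side against its own mirror image:
the two resulting histories of `v` are independent, equally distributed and take at most `5 ^ t`
values, so they agree with probability at least `5⁻ᵗ` (`IsMirror.pow_le_measureReal`). If they
agree, the real execution looks the same to `v`, which is therefore still active
(`IsMirror.history_eq`). For `t` about `(log n) / 8`, a ring or a union of edges contains so many
disjoint mirrors that agreement occurs somewhere with high probability (`probWithin_le_pow`).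

Upper bound. A node at level `j` beeps with probability `2⁻⁽ʲ⁺¹⁾`; hearing a beep raises the level,
silence lowers it, and beeping alone ends with the slot number as colour. Fix `v` and let its mass
be the sum of the beeping probabilities of its neighbours. If the mass is small, `v` mostly hears
nothing, so its level falls or it terminates. Otherwise, either the neighbours mostly hear beeps and
the mass shrinks, or, by the second moment method, some neighbour terminates with constant
probability. So a weighted sum of level, logarithmic mass and number of active neighbours has
negative drift (`exists_drift`), and its exponential decays geometrically in expectation
(`integral_potential_next_le`). It starts at `exp (O(Δ))` and is bounded below while `v` is active;
Markov's inequality and a union bound conclude. -/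

namespace Beeping

/-- A numbering of the actions. -/
def Action.code : Action → ℕ
  | .beep => 0
  | .listen => 1
  | .halt c => c + 2

theorem Action.code_injective : Function.Injective Action.code := by
  intro a b h
  cases a <;> cases b <;> simp_all [Action.code]

instance : Countable Action := Action.code_injective.countable

noncomputable instance : DecidableEq Percept := Classical.decEq _

noncomputable instance : Fintype Percept where
  elems := {.beepedAlone, .beepedWithOthers, .silence, .oneBeep, .severalBeeps}
  complete := by rintro (_ | _ | _ | _ | _) <;> simp

theorem card_percept : Fintype.card Percept = 5 := by
  change Finset.card ({.beepedAlone, .beepedWithOthers, .silence, .oneBeep, .severalBeeps} :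
    Finset Percept) = 5
  simp

/-! ### Executions and typical seeds -/

namespace Algorithm

variable {A : Algorithm} {V : Type} {G : SimpleGraph V} {ω ω' : V → A.Seed}

/-- The number of beeping neighbours of `v` in the slot that follows `t` slots. -/
noncomputable def beeps (A : Algorithm) (G : SimpleGraph V) (ω : V → A.Seed) (t : ℕ) (v : V) : ℕ :=
  {u : V | G.Adj v u ∧ A.act (ω u) (A.history G ω t u) = Action.beep}.ncard

theorem history_succ_of_beep {t : ℕ} {v : V}
    (h : A.act (ω v) (A.history G ω t v) = .beep) :
    A.history G ω (t + 1) v = perceive true (A.beeps G ω t v) :: A.history G ω t v := by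
  simp [history, step, h, beeps]

theorem history_succ_of_listen {t : ℕ} {v : V}
    (h : A.act (ω v) (A.history G ω t v) = .listen) :
    A.history G ω (t + 1) v = perceive false (A.beeps G ω t v) :: A.history G ω t v := by
  simp [history, step, h, beeps]

theorem history_succ_of_halt {t : ℕ} {v : V} {c : ℕ}
    (h : A.act (ω v) (A.history G ω t v) = .halt c) :
    A.history G ω (t + 1) v = A.history G ω t v := by
  simp [history, step, h]

theorem length_history_le (t : ℕ) (v : V) : (A.history G ω t v).length ≤ t := by
  induction t with
  | zero => simp [history]
  | succ t ih =>
    cases h : A.act (ω v) (A.history G ω t v) with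
    | beep => simp [history_succ_of_beep h, ih]
    | listen => simp [history_succ_of_listen h, ih]
    | halt c => rw [history_succ_of_halt h]; omega

theorem HasColour.succ {t c : ℕ} {v : V} (h : A.HasColour G ω t v c) :
    A.HasColour G ω (t + 1) v c := by
  unfold HasColour at *
  rwa [history_succ_of_halt h]

theorem HasColour.mono {s t c : ℕ} {v : V} (h : A.HasColour G ω s v c) (hst : s ≤ t) :
    A.HasColour G ω t v c := by
  induction t, hst using Nat.le_induction with
  | base => exact h
  | succ t _ ih => exact ih.succ

theorem TerminatedBy.mono {s t : ℕ} (h : A.TerminatedBy G ω s) (hst : s ≤ t) :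
    A.TerminatedBy G ω t := fun v => (h v).imp fun _ hc => hc.mono hst

/-- In the first `t` slots a node consults its seed only at histories shorter than `t`, since at
most one percept is recorded per slot. -/
theorem history_congr {t : ℕ}
    (h : ∀ v l, l.length < t → A.act (ω v) l = A.act (ω' v) l) :
    A.history G ω t = A.history G ω' t := by
  induction t with
  | zero => rfl
  | succ t ih =>
    have ih := ih fun v l hl => h v l (by omega)
    have key : ∀ v, A.act (ω v) (A.history G ω' t v) = A.act (ω' v) (A.history G ω' t v) :=
      fun v => h v _ (by have := length_history_le (A := A) (G := G) (ω := ω') t v; omega)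
    funext v
    simp only [history, step, ih, key]

/-- A seed is typical if, for every time bound, seeds behaving in the same way up to that bound
have positive probability. -/
def Typical (A : Algorithm) (r : A.Seed) : Prop :=
  ∀ t : ℕ, A.law {r' | ∀ l : List Percept, l.length ≤ t → A.act r' l = A.act r l} ≠ 0

/-- There are finitely many histories of length at most `t` and countably many actions, hence
countably many behaviours up to `t`; those of probability zero form a null set together. -/
theorem ae_typical (A : Algorithm) : ∀ᵐ r ∂A.law, A.Typical r := by
  unfold Typical
  rw [ae_all_iff]
  intro t
  have hfin : Finite {l : List Percept // l.length ≤ t} := (List.finite_length_le Percept t).to_subtype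
  let f : A.Seed → ({l : List Percept // l.length ≤ t} → Action) := fun r l => A.act r l
  have hset : ∀ r, {r' | ∀ l : List Percept, l.length ≤ t → A.act r' l = A.act r l} = f ⁻¹' {f r} := by
    intro r
    ext r'
    simp [f, funext_iff]
  simp only [hset]
  have hsub : {r | ¬ A.law (f ⁻¹' {f r}) ≠ 0} ⊆
      ⋃ g : {g : {l : List Percept // l.length ≤ t} → Action // A.law (f ⁻¹' {g}) = 0}, f ⁻¹' {g.1} := by
    intro r hr
    simp only [ne_eq, not_not, Set.mem_ofPred_eq] at hr
    exact Set.mem_iUnion.2 ⟨⟨f r, hr⟩, rfl⟩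
  exact measure_mono_null hsub (measure_iUnion_null fun g => g.2)

theorem ae_forall_typical [Fintype V] (A : Algorithm) :
    ∀ᵐ ω ∂A.seeds V, ∀ v, A.Typical (ω v) := by
  rw [ae_all_iff]
  intro v
  exact (measurePreserving_eval (fun _ : V => A.law) v).quasiMeasurePreserving.ae (ae_typical A)

/-- An algorithm that colours `G` properly almost surely colours it properly for all typical
seeds. -/
theorem IsLasVegasColouringOn.isProper_of_typical [Fintype V] (hA : A.IsLasVegasColouringOn G)
    (hω : ∀ v, A.Typical (ω v)) : A.IsProper G ω := by
  intro u v huv t c ⟨hu, hv⟩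
  -- By independence, a violation at time `t` would recur on a product of cylinders of positive
  -- measure, which must contain a good assignment of seeds.
  have hpos : A.seeds V (Set.univ.pi fun v =>
      {r' | ∀ l : List Percept, l.length ≤ t → A.act r' l = A.act (ω v) l}) ≠ 0 := by
    unfold seeds
    rw [Measure.pi_pi, Finset.prod_ne_zero_iff]
    exact fun v _ => hω v t
  obtain ⟨ω', hω', hprop⟩ : ∃ ω' ∈ (Set.univ.pi fun v =>
      {r' | ∀ l : List Percept, l.length ≤ t → A.act r' l = A.act (ω v) l}), A.IsProper G ω' := by
    by_contra! hcon
    refine hpos (measure_mono_null (fun ω' h' => ?_) hA)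
    exact fun h => hcon ω' h' h.2
  have hω'' : ∀ v l, l.length ≤ t → A.act (ω' v) l = A.act (ω v) l := fun v l hl => hω' v trivial l hl
  have hist := history_congr (G := G) (t := t) fun v l hl => hω'' v l hl.le
  refine hprop u v huv t c ⟨?_, ?_⟩ <;> unfold HasColour <;>
    rw [hist, hω'' _ _ (length_history_le _ _)] <;> assumption

/-! ### Closed twins -/

/-- Counting saturates at one beep for a beeping node and at two for a listening one; this is what
hides the beeps of a twin. -/
theorem perceive_eq_of_le {b : Bool} {m n : ℕ} (h : m ≤ n)
    (h' : n = m ∨ 2 ≤ m ∨ (b = true ∧ 1 ≤ m)) : perceive b n = perceive b m := by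
  rcases h' with rfl | h' | ⟨rfl, h'⟩
  · rfl
  · obtain ⟨m, rfl⟩ := Nat.exists_eq_add_of_le' h'
    obtain ⟨n, rfl⟩ := Nat.exists_eq_add_of_le' (h'.trans h)
    cases b <;> rfl
  · obtain ⟨m, rfl⟩ := Nat.exists_eq_add_of_le' h'
    obtain ⟨n, rfl⟩ := Nat.exists_eq_add_of_le' (h'.trans h)
    rfl

/-- The map that sends a new last node to `v`. -/
def collapse {n : ℕ} (v : Fin n) : Fin (n + 1) → Fin n := Fin.lastCases v id

@[simp] theorem collapse_castSucc {n : ℕ} (v w : Fin n) : collapse v w.castSucc = w := by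
  simp [collapse]

@[simp] theorem collapse_last {n : ℕ} (v : Fin n) : collapse v (Fin.last n) = v := by
  simp [collapse]

/-- The graph obtained from `G` by adding a closed twin of `v`. -/
def addTwin {n : ℕ} (G : SimpleGraph (Fin n)) (v : Fin n) : SimpleGraph (Fin (n + 1)) where
  Adj x y := x ≠ y ∧ (collapse v x = collapse v y ∨ G.Adj (collapse v x) (collapse v y))
  symm := ⟨fun _ _ h => ⟨h.1.symm, h.2.imp Eq.symm SimpleGraph.Adj.symm⟩⟩
  loopless := ⟨fun _ h => h.1 rfl⟩

/-- Complete graphs are closed under adding twins, so for them the twin argument needs correctness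
on complete graphs only. -/
theorem addTwin_top {n : ℕ} (v : Fin n) : addTwin (⊤ : SimpleGraph (Fin n)) v = ⊤ := by
  ext x y
  simp [addTwin, em]

/-- If adjacency is transitive and `v` never beeps alone, a twin of `v` with the same seed has the
same history as `v`, and does not change any other history. -/
theorem history_addTwin {n : ℕ} {G : SimpleGraph (Fin n)}
    (htrans : ∀ x y z, G.Adj x y → G.Adj y z → x ≠ z → G.Adj x z) (v : Fin n)
    {ω : Fin n → A.Seed} {t : ℕ}
    (hv : ∀ s < t, A.act (ω v) (A.history G ω s v) = .beep → A.beeps G ω s v ≠ 0)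
    (x : Fin (n + 1)) :
    A.history (addTwin G v) (ω ∘ collapse v) t x = A.history G ω t (collapse v x) := by
  induction t generalizing x with
  | zero => rfl
  | succ t ih =>
    replace ih := ih fun s hs => hv s (by omega)
    set beeping : Fin n → Prop := fun u => A.act (ω u) (A.history G ω t u) = .beep with hb
    have hset : A.beeps (addTwin G v) (ω ∘ collapse v) t x =
        {y | (addTwin G v).Adj x y ∧ beeping (collapse v y)}.ncard := by
      simp [beeps, ih, hb]
    have hold : A.beeps G ω t (collapse v x) =
        {u | G.Adj (collapse v x) u ∧ beeping u}.ncard := rfl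
    have hsub : Fin.castSucc '' {u | G.Adj (collapse v x) u ∧ beeping u} ⊆
        {y | (addTwin G v).Adj x y ∧ beeping (collapse v y)} := by
      rintro _ ⟨u, ⟨hu, hu'⟩, rfl⟩
      refine ⟨⟨?_, ?_⟩, by simpa using hu'⟩
      · rintro rfl
        simp at hu
      · simpa using Or.inr hu
    have hcard := Set.ncard_image_of_injective {u | G.Adj (collapse v x) u ∧ beeping u}
      (Fin.castSucc_injective n)
    have hle : A.beeps G ω t (collapse v x) ≤ A.beeps (addTwin G v) (ω ∘ collapse v) t x := by
      rw [hset, hold, ← hcard]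
      exact Set.ncard_le_ncard hsub (Set.toFinite _)
    have hvt := hv t (by omega)
    -- The count can change only through the doubling of a beep of `v`, and only in the closed
    -- neighbourhood of `v`.
    have hcases : A.beeps (addTwin G v) (ω ∘ collapse v) t x = A.beeps G ω t (collapse v x) ∨
        (beeping v ∧ (collapse v x = v ∨ G.Adj (collapse v x) v)) := by
      by_contra! hcon
      refine hcon.1 ?_
      rw [hset, hold, ← hcard]
      congr 1
      refine Set.Subset.antisymm (fun y hy => ?_) hsub
      obtain ⟨⟨hxy, hadj⟩, hyb⟩ := hy
      induction y using Fin.lastCases with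
      | last =>
        simp only [collapse_last] at hadj hyb
        exact absurd hadj (by have := hcon.2 hyb; tauto)
      | cast u =>
        simp only [collapse_castSucc] at hadj hyb
        refine ⟨u, ⟨?_, hyb⟩, rfl⟩
        rcases hadj with hadj | hadj
        · exfalso
          induction x using Fin.lastCases with
          | last =>
            simp only [collapse_last] at hadj hcon
            exact (hcon.2 (hadj ▸ hyb)).1 rfl
          | cast w => simp at hadj; exact hxy (by rw [hadj])
        · exact hadj
    have hperc : ∀ b, A.act (ω (collapse v x)) (A.history G ω t (collapse v x)) =
        (if b then .beep else .listen) →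
        perceive b (A.beeps (addTwin G v) (ω ∘ collapse v) t x) =
          perceive b (A.beeps G ω t (collapse v x)) := by
      intro b hact
      refine perceive_eq_of_le hle ?_
      rcases hcases with h | ⟨hvb, h⟩
      · exact Or.inl h
      · right
        have hpos : 1 ≤ A.beeps G ω t (collapse v x) := by
          rcases h with h | h
          · rw [h]; exact Nat.one_le_iff_ne_zero.2 (hvt hvb)
          · rw [hold, Nat.one_le_iff_ne_zero, ← Nat.pos_iff_ne_zero, Set.ncard_pos (Set.toFinite _)]
            exact ⟨v, h, hvb⟩
        -- For a beeping node one beeping neighbour already saturates the percept. A listening node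
        -- next to `v` hears two beeps already: that of `v` and, by transitivity, that of the node
        -- `u` which `v` hears.
        cases b with
        | true => exact Or.inr ⟨rfl, hpos⟩
        | false =>
          left
          simp only [Bool.false_eq_true, if_false] at hact
          have hne : collapse v x ≠ v := by
            intro h
            rw [h] at hact
            simp only [hb] at hvb
            rw [hact] at hvb
            cases hvb
          have hadj := h.resolve_left hne
          obtain ⟨u, hu, hub⟩ := (Set.ncard_pos (Set.toFinite _)).1
            (Nat.pos_of_ne_zero (hvt hvb))
          rw [hold]
          have hxu : collapse v x ≠ u := by
            rintro h
            rw [← h, hact] at hub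
            cases hub
          rw [← Set.ncard_pair hu.ne]
          refine Set.ncard_le_ncard ?_ (Set.toFinite _)
          rintro y (rfl | rfl)
          · exact ⟨hadj, hvb⟩
          · exact ⟨htrans _ _ _ hadj hu hxu, hub⟩
    have hact : A.act ((ω ∘ collapse v) x) (A.history (addTwin G v) (ω ∘ collapse v) t x) =
        A.act (ω (collapse v x)) (A.history G ω t (collapse v x)) := by rw [ih]; rfl
    cases h : A.act (ω (collapse v x)) (A.history G ω t (collapse v x)) with
    | beep =>
      rw [history_succ_of_beep h, history_succ_of_beep (hact.trans h), ih, hperc true (by simpa)]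
    | listen =>
      rw [history_succ_of_listen h, history_succ_of_listen (hact.trans h), ih,
        hperc false (by simpa)]
    | halt c => rw [history_succ_of_halt h, history_succ_of_halt (hact.trans h), ih]

/-- If adjacency is transitive, nodes of a clique have to beep alone before they terminate. -/
theorem card_le_of_terminatedBy {n : ℕ} {G : SimpleGraph (Fin n)}
    (htrans : ∀ x y z, G.Adj x y → G.Adj y z → x ≠ z → G.Adj x z)
    (hA : ∀ v, A.IsLasVegasColouringOn (addTwin G v)) {ω : Fin n → A.Seed}
    (hω : ∀ v, A.Typical (ω v)) {t : ℕ} (ht : A.TerminatedBy G ω t)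
    {s : Finset (Fin n)} (hs : ∀ x ∈ s, ∀ y ∈ s, x ≠ y → G.Adj x y) : s.card ≤ t := by
  -- Otherwise a twin of `v` with the same seed would follow `v` up to time `t` and terminate with
  -- the same colour.
  have key : ∀ v, ∃ i < t, A.act (ω v) (A.history G ω i v) = .beep ∧ A.beeps G ω i v = 0 := by
    intro v
    by_contra! hcon
    have hist := history_addTwin htrans v hcon
    obtain ⟨c, hc⟩ := ht v
    have hne : (Fin.last n) ≠ v.castSucc := (Fin.castSucc_ne_last v).symm
    refine (hA v).isProper_of_typical (ω := ω ∘ collapse v) (fun x => hω _)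
      (Fin.last n) v.castSucc ⟨hne, by simp⟩ t c ⟨?_, ?_⟩ <;>
    · unfold HasColour
      rw [hist]
      simpa [HasColour] using hc
  choose f hf hbeep hzero using key
  -- Two adjacent nodes cannot both beep alone in the same slot.
  have hinj : Set.InjOn f s := by
    intro x hx y hy hxy
    by_contra hne
    have h0 := hzero x
    unfold beeps at h0
    rw [Set.ncard_eq_zero (Set.toFinite _)] at h0
    have : y ∈ {u | G.Adj x u ∧ A.act (ω u) (A.history G ω (f x) u) = .beep} :=
      ⟨hs x hx y hy hne, by rw [hxy]; exact hbeep y⟩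
    rw [h0] at this
    exact this
  have := Finset.card_le_card_of_injOn (t := Finset.range t) f (fun x _ => by simpa using hf x) hinj
  simpa using this

theorem ae_le_of_terminatedBy_top (hA : ∀ m : ℕ, A.IsLasVegasColouringOn (⊤ : SimpleGraph (Fin m)))
    (n : ℕ) : ∀ᵐ ω ∂A.seeds (Fin n),
      ∀ t : ℕ, A.TerminatedBy (⊤ : SimpleGraph (Fin n)) ω t → n ≤ t := by
  filter_upwards [ae_forall_typical (V := Fin n) A] with ω hω t ht
  have := card_le_of_terminatedBy (s := Finset.univ) (fun x y z _ _ h => h)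
    (fun v => by rw [addTwin_top]; exact hA _) hω ht (fun x _ y _ h => h)
  simpa using this

end Algorithm

end Beeping

namespace Beeping

/-! ### Independence of events on disjoint sets of nodes -/

instance : MeasurableSpace Action := ⊤
instance : DiscreteMeasurableSpace Action := ⟨fun _ => trivial⟩
instance : MeasurableSpace (List Percept) := ⊤
instance : DiscreteMeasurableSpace (List Percept) := ⟨fun _ => trivial⟩

/-- Events that depend on disjoint sets of coordinates are independent. -/
theorem measure_inter_of_disjoint {ι α : Type*} [Fintype ι] [MeasurableSpace α] (μ : Measure α)
    [IsProbabilityMeasure μ] {S T : Finset ι} (hST : Disjoint S T) {E F : Set (ι → α)}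
    (hE : MeasurableSet E) (hF : MeasurableSet F)
    (hES : ∀ x y : ι → α, (∀ i ∈ S, x i = y i) → x ∈ E → y ∈ E)
    (hFT : ∀ x y : ι → α, (∀ i ∈ T, x i = y i) → x ∈ F → y ∈ F) :
    (Measure.pi fun _ : ι => μ) (E ∩ F) =
      (Measure.pi fun _ : ι => μ) E * (Measure.pi fun _ : ι => μ) F := by
  classical
  obtain ⟨r⟩ : Nonempty α := nonempty_of_isProbabilityMeasure μ
  -- Filling the coordinates outside `U` with the fixed value `r` exhibits an event that depends on
  -- `U` only as the preimage of a measurable set under restriction to `U`.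
  let ext (U : Finset ι) (η : U → α) (i : ι) : α := if h : i ∈ U then η ⟨i, h⟩ else r
  have hext : ∀ U, Measurable (ext U) := by
    intro U
    refine measurable_pi_iff.2 fun i => ?_
    by_cases h : i ∈ U
    · simpa [ext, h] using measurable_pi_apply _
    · simp [ext, h]
  have hpre : ∀ (U : Finset ι) (D : Set (ι → α)),
      (∀ x y : ι → α, (∀ i ∈ U, x i = y i) → x ∈ D → y ∈ D) →
      D = (fun x (i : U) => x i) ⁻¹' (ext U ⁻¹' D) := by
    intro U D hD
    have hagree : ∀ x : ι → α, ∀ i ∈ U, x i = ext U (fun i : U => x i) i := by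
      intro x i hi
      simp [ext, hi]
    ext x
    exact ⟨hD _ _ (hagree x), hD _ _ fun i hi => (hagree x i hi).symm⟩
  have hind : ProbabilityTheory.iIndepFun (fun (i : ι) (x : ι → α) => x i)
      (Measure.pi fun _ : ι => μ) :=
    ProbabilityTheory.iIndepFun_pi (X := fun _ : ι => (id : α → α)) fun _ => aemeasurable_id
  have h2 := hind.indepFun_finset S T hST fun i => measurable_pi_apply i
  have := h2.measure_inter_preimage_eq_mul _ _ (hext S hE) (hext T hF)
  rwa [← hpre S E hES, ← hpre T F hFT] at this

/-- If each of `m` events has probability at most `q` and they depend on disjoint sets of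
coordinates, they occur simultaneously with probability at most `q ^ m`. -/
theorem measureReal_biInter_le_pow {ι α : Type*} [Fintype ι] [MeasurableSpace α] (μ : Measure α)
    [IsProbabilityMeasure μ] {q : ℝ} (m : ℕ) {S : ℕ → Finset ι} {F : ℕ → Set (ι → α)}
    (hS : ∀ i k, i < k → k < m → Disjoint (S i) (S k))
    (hF : ∀ i < m, MeasurableSet (F i))
    (hFS : ∀ i < m, ∀ x y : ι → α, (∀ a ∈ S i, x a = y a) → x ∈ F i → y ∈ F i)
    (hq : ∀ i < m, (Measure.pi fun _ : ι => μ).real (F i) ≤ q) :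
    (Measure.pi fun _ : ι => μ).real (⋂ i < m, F i) ≤ q ^ m := by
  classical
  induction m with
  | zero => simp
  | succ m ih =>
    have ih := ih (fun i k hik hk => hS i k hik (by omega)) (fun i hi => hF i (by omega))
      (fun i hi => hFS i (by omega)) (fun i hi => hq i (by omega))
    have hset : (⋂ i < m + 1, F i) = (⋂ i < m, F i) ∩ F m := by
      ext x
      simp only [Set.mem_iInter, Set.mem_inter_iff, Nat.lt_succ_iff_lt_or_eq, or_imp, forall_and,
        forall_eq]
    have hmul := measure_inter_of_disjoint μ (S := (Finset.range m).biUnion S) (T := S m)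
      (E := ⋂ i < m, F i) (F := F m)
      (by
        rw [Finset.disjoint_biUnion_left]
        exact fun i hi => hS i m (by simpa using hi) (by omega))
      (MeasurableSet.iInter fun i => MeasurableSet.iInter fun hi => hF i (by omega))
      (hF m (by omega))
      (by
        intro x y hxy hx
        simp only [Set.mem_iInter] at hx ⊢
        exact fun i hi => hFS i (by omega) x y
          (fun a ha => hxy a (Finset.mem_biUnion.2 ⟨i, by simpa using hi, ha⟩)) (hx i hi))
      (hFS m (by omega))
    rw [hset, measureReal_def, hmul, ENNReal.toReal_mul, ← measureReal_def, ← measureReal_def,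
      pow_succ]
    have h0 : 0 ≤ q := measureReal_nonneg.trans (hq m (by omega))
    exact mul_le_mul ih (hq m (by omega)) measureReal_nonneg (pow_nonneg h0 _)

/-! ### Mirrors across an edge -/

namespace Algorithm

variable {A : Algorithm} {V : Type} {G : SimpleGraph V} {ω : V → A.Seed}

theorem measurable_act (A : Algorithm) :
    Measurable fun p : A.Seed × List Percept => A.act p.1 p.2 :=
  measurable_from_prod_countable_left fun l => measurable_to_countable' fun a =>
    A.measurableSet_act l a

theorem measurable_history [Finite V] (A : Algorithm) (G : SimpleGraph V) (t : ℕ) :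
    Measurable fun ω : V → A.Seed => A.history G ω t := by
  induction t with
  | zero => exact measurable_const
  | succ t ih =>
    have hact : Measurable fun (ω : V → A.Seed) (v : V) => A.act (ω v) (A.history G ω t v) := by
      refine measurable_pi_iff.2 fun v => ?_
      exact (measurable_act A).comp
        ((measurable_pi_apply v).prodMk ((measurable_pi_apply v).comp ih))
    -- One slot is a function of countable discrete data, so its measurability is automatic.
    let Φ : (V → Action) × (V → List Percept) → (V → List Percept) := fun p v =>
      match p.1 v with
      | Action.beep => perceive true {u : V | G.Adj v u ∧ p.1 u = Action.beep}.ncard :: p.2 v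
      | Action.listen => perceive false {u : V | G.Adj v u ∧ p.1 u = Action.beep}.ncard :: p.2 v
      | Action.halt _ => p.2 v
    exact (Measurable.of_discrete (f := Φ)).comp (hact.prodMk ih)

/-- Whether a percept is that of a beeping node. -/
def _root_.Beeping.Percept.whileBeeping : Percept → Bool
  | .beepedAlone => true
  | .beepedWithOthers => true
  | _ => false

theorem _root_.Beeping.whileBeeping_perceive (b : Bool) (n : ℕ) :
    (perceive b n).whileBeeping = b := by
  match b, n with
  | true, 0 => rfl
  | true, _ + 1 => rfl
  | false, 0 => rfl
  | false, 1 => rfl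
  | false, _ + 2 => rfl

/-- Percepts reveal whether the node itself beeped, so equal histories of an active node imply equal
beeps in all earlier slots. -/
theorem exists_history_succ {t : ℕ} {v : V} (h : ∀ c, ¬ A.HasColour G ω t v c) :
    ∃ p : Percept, A.history G ω (t + 1) v = p :: A.history G ω t v ∧
      (p.whileBeeping = true ↔ A.act (ω v) (A.history G ω t v) = .beep) := by
  cases hact : A.act (ω v) (A.history G ω t v) with
  | beep => exact ⟨_, history_succ_of_beep hact, by simp [whileBeeping_perceive]⟩
  | listen => exact ⟨_, history_succ_of_listen hact, by simp [whileBeeping_perceive]⟩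
  | halt c => exact absurd hact (h c)

/-- The next history depends only on the own seed, the own history and the beeping
neighbours. -/
theorem history_succ_congr {ω₁ ω₂ : V → A.Seed} {t : ℕ} {v : V} (hs : ω₁ v = ω₂ v)
    (hh : A.history G ω₁ t v = A.history G ω₂ t v)
    (hn : ∀ u, G.Adj v u → (A.act (ω₁ u) (A.history G ω₁ t u) = .beep ↔
      A.act (ω₂ u) (A.history G ω₂ t u) = .beep)) :
    A.history G ω₁ (t + 1) v = A.history G ω₂ (t + 1) v := by
  have hset : {u : V | G.Adj v u ∧ A.act (ω₁ u) (A.history G ω₁ t u) = .beep} =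
      {u : V | G.Adj v u ∧ A.act (ω₂ u) (A.history G ω₂ t u) = .beep} := by
    ext u
    exact and_congr_right fun h => hn u h
  simp only [history, step, hset, hs, hh]

/-- Histories are invariant under a graph automorphism that preserves the seeds. -/
theorem history_comp_equiv (σ : V ≃ V) (hσ : ∀ x y, G.Adj (σ x) (σ y) ↔ G.Adj x y)
    (hω : ∀ x, ω (σ x) = ω x) (t : ℕ) (x : V) :
    A.history G ω t (σ x) = A.history G ω t x := by
  induction t generalizing x with
  | zero => rfl
  | succ t ih =>
    have hset : {u : V | G.Adj (σ x) u ∧ A.act (ω u) (A.history G ω t u) = .beep} =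
        σ '' {u : V | G.Adj x u ∧ A.act (ω u) (A.history G ω t u) = .beep} := by
      ext u
      obtain ⟨u, rfl⟩ := σ.surjective u
      simp [hσ, hω, ih]
    simp only [history, step, hset, Set.ncard_image_of_injective _ σ.injective, hω, ih]

/-- A mirror of depth `t` at the edge between `v` and `σ v`: the involutive automorphism `σ`
exchanges both sides of the edge, and during the first `s` of the `t` slots, the nodes in `L s` can
be influenced from outside of `L 0` only via this edge. -/
structure IsMirror (G : SimpleGraph V) (t : ℕ) (v : V) (σ : V ≃ V) (L : ℕ → Finset V) : Prop where
  apply_apply : ∀ x, σ (σ x) = x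
  adj_apply : ∀ x y, G.Adj (σ x) (σ y) ↔ G.Adj x y
  adj : G.Adj v (σ v)
  mem : v ∈ L t
  antitone : Antitone L
  mem_of_adj : ∀ s x y, x ∈ L (s + 1) → G.Adj x y → y ∈ L s ∨ (x = v ∧ y = σ v)
  apply_notMem : ∀ x ∈ L 0, σ x ∉ L 0

open Classical in
/-- The seeds on `L` and their mirror images; the remaining nodes receive the seed `r`. -/
noncomputable def mirrored {S : Type} (σ : V ≃ V) (L : Finset V) (r : S) (ω : V → S) (x : V) : S :=
  if x ∈ L then ω x else if σ x ∈ L then ω (σ x) else r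

theorem typical_mirrored (σ : V ≃ V) (L : Finset V) {r : A.Seed} (hr : A.Typical r) (hω : ∀ x, A.Typical (ω x)) (x : V) :
    A.Typical (mirrored σ L r ω x) := by
  unfold mirrored
  split_ifs
  exacts [hω _, hω _, hr]

theorem measurable_mirrored (σ : V ≃ V) (L : Finset V) (r : A.Seed) :
    Measurable fun ω : V → A.Seed => mirrored σ L r ω := by
  refine measurable_pi_iff.2 fun x => ?_
  unfold mirrored
  split_ifs
  exacts [measurable_pi_apply _, measurable_pi_apply _, measurable_const]

namespace IsMirror

variable {t : ℕ} {v : V} {σ : V ≃ V} {L : ℕ → Finset V} (hL : IsMirror G t v σ L)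
include hL

theorem mirrored_apply {S : Type} (r : S) (ω : V → S) (x : V) :
    mirrored σ (L 0) r ω (σ x) = mirrored σ (L 0) r ω x := by
  unfold mirrored
  by_cases h : x ∈ L 0
  · simp [h, hL.apply_notMem x h, hL.apply_apply]
  · by_cases h' : σ x ∈ L 0 <;> simp [h, h', hL.apply_apply]

/-- The mirrored seeds are typical and invariant under `σ`, so the neighbours `v` and `σ v` always
have the same history; a colour of one would be a colour of both. -/
theorem not_hasColour_mirrored [Fintype V] (hA : A.IsLasVegasColouringOn G) {r : A.Seed}
    (hr : A.Typical r) (hω : ∀ x, A.Typical (ω x)) (s c : ℕ) :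
    ¬ A.HasColour G (mirrored σ (L 0) r ω) s v c := by
  intro h
  refine hA.isProper_of_typical (typical_mirrored σ (L 0) hr hω) v (σ v) hL.adj s c ⟨h, ?_⟩
  unfold HasColour at *
  rwa [hL.mirrored_apply, history_comp_equiv σ hL.adj_apply (hL.mirrored_apply r ω)]

/-- If both sides of a mirror would evolve in the same way next to their own mirror images, then
they evolve in this way next to each other. -/
theorem history_eq [Fintype V] (hA : A.IsLasVegasColouringOn G) {r : A.Seed}
    (hr : A.Typical r) (hω : ∀ x, A.Typical (ω x))
    (heq : A.history G (mirrored σ (L 0) r ω) t v =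
      A.history G (mirrored σ (L 0) r (ω ∘ σ)) t v) {s : ℕ} (hs : s ≤ t) :
    (∀ x ∈ L s, A.history G ω s x = A.history G (mirrored σ (L 0) r ω) s x) ∧
    (∀ x, σ x ∈ L s → A.history G ω s x = A.history G (mirrored σ (L 0) r (ω ∘ σ)) s x) := by
  set ω₁ := mirrored σ (L 0) r ω with hω₁
  set ω₂ := mirrored σ (L 0) r (ω ∘ σ) with hω₂
  have hn₁ : ∀ s c, ¬ A.HasColour G ω₁ s v c := hL.not_hasColour_mirrored hA hr hω
  have hn₂ : ∀ s c, ¬ A.HasColour G ω₂ s v c :=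
    hL.not_hasColour_mirrored hA hr fun x => hω (σ x)
  -- In both mirrored executions `v` never terminates, so each slot adds one percept and equality at
  -- time `t` descends to all earlier times.
  have heqs : ∀ s ≤ t, A.history G ω₁ s v = A.history G ω₂ s v := by
    intro s hs
    induction hs using Nat.decreasingInduction with
    | self => exact heq
    | of_succ s _ ih =>
      obtain ⟨p₁, h₁, -⟩ := exists_history_succ (hn₁ s)
      obtain ⟨p₂, h₂, -⟩ := exists_history_succ (hn₂ s)
      rw [h₁, h₂] at ih
      exact (List.cons.inj ih).2
  have hbeep : ∀ s < t, (A.act (ω₁ v) (A.history G ω₁ s v) = .beep ↔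
      A.act (ω₂ v) (A.history G ω₂ s v) = .beep) := by
    intro s hs
    obtain ⟨p₁, h₁, h₁'⟩ := exists_history_succ (hn₁ s)
    obtain ⟨p₂, h₂, h₂'⟩ := exists_history_succ (hn₂ s)
    have := heqs (s + 1) hs
    rw [h₁, h₂] at this
    rw [← h₁', ← h₂', (List.cons.inj this).1]
  have hsymm₁ := hL.mirrored_apply r ω
  have hsymm₂ := hL.mirrored_apply r (ω ∘ σ)
  rw [← hω₁] at hsymm₁
  rw [← hω₂] at hsymm₂
  have hhist₁ := fun s => history_comp_equiv (A := A) σ hL.adj_apply hsymm₁ s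
  have hhist₂ := fun s => history_comp_equiv (A := A) σ hL.adj_apply hsymm₂ s
  have hseed₁ : ∀ x ∈ L 0, ω x = ω₁ x := by
    intro x hx
    simp [hω₁, mirrored, hx]
  have hseed₂ : ∀ x, σ x ∈ L 0 → ω x = ω₂ x := by
    intro x hx
    have := hL.apply_notMem _ hx
    rw [hL.apply_apply] at this
    simp [hω₂, mirrored, hx, this, hL.apply_apply]
  induction s with
  | zero => exact ⟨fun _ _ => rfl, fun _ _ => rfl⟩
  | succ s ih =>
    obtain ⟨ih₁, ih₂⟩ := ih (by omega)
    have h0 : ∀ {x} {s : ℕ}, x ∈ L s → x ∈ L 0 := fun hx => hL.antitone (Nat.zero_le _) hx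
    have hvs : v ∈ L s := hL.antitone (by omega : s ≤ t) hL.mem
    constructor
    · intro x hx
      refine history_succ_congr (hseed₁ x (h0 hx)) (ih₁ x (hL.antitone (Nat.le_succ s) hx)) ?_
      intro y hxy
      rcases hL.mem_of_adj s x y hx hxy with hy | ⟨rfl, rfl⟩
      · rw [hseed₁ y (h0 hy), ih₁ y hy]
      -- Only here does the other side matter: `σ v` behaves as in `ω₂`, and there it beeps exactly
      -- when `v` does in `ω₁`, which is what `v` meets across the edge in `ω₁`.
      · have hmem : σ (σ x) ∈ L s := by rwa [hL.apply_apply]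
        rw [hseed₂ _ (h0 hmem), ih₂ _ hmem, hsymm₁, hsymm₂, hhist₁, hhist₂]
        exact (hbeep s (by omega)).symm
    · intro x hx
      refine history_succ_congr (hseed₂ x (h0 hx)) (ih₂ x (hL.antitone (Nat.le_succ s) hx)) ?_
      intro y hxy
      rcases hL.mem_of_adj s (σ x) (σ y) hx ((hL.adj_apply _ _).2 hxy) with hy | ⟨hxv, hyv⟩
      · rw [hseed₂ y (h0 hy), ih₂ y hy]
      · obtain rfl : y = v := σ.injective hyv
        rw [hseed₁ _ (h0 hvs), ih₁ _ hvs]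
        exact hbeep s (by omega)

theorem not_hasColour [Fintype V] (hA : A.IsLasVegasColouringOn G) {r : A.Seed}
    (hr : A.Typical r) (hω : ∀ x, A.Typical (ω x))
    (heq : A.history G (mirrored σ (L 0) r ω) t v =
      A.history G (mirrored σ (L 0) r (ω ∘ σ)) t v) (c : ℕ) : ¬ A.HasColour G ω t v c := by
  have h := (hL.history_eq hA hr hω heq le_rfl).1 v hL.mem
  have h0 : v ∈ L 0 := hL.antitone (Nat.zero_le _) hL.mem
  intro hc
  refine hL.not_hasColour_mirrored hA hr hω t c ?_
  unfold HasColour at *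
  rw [← h]
  simpa [mirrored, h0] using hc

theorem length_history_mirrored [Fintype V] (hA : A.IsLasVegasColouringOn G) {r : A.Seed}
    (hr : A.Typical r) (hω : ∀ x, A.Typical (ω x)) (s : ℕ) :
    (A.history G (mirrored σ (L 0) r ω) s v).length = s := by
  induction s with
  | zero => rfl
  | succ s ih =>
    obtain ⟨p, h, -⟩ := exists_history_succ (hL.not_hasColour_mirrored hA hr hω s)
    rw [h, List.length_cons, ih]

/-- Both sides of a mirror evolve in the same way with probability at least `5⁻ᵗ`. -/
theorem pow_le_measureReal [Fintype V] (hA : A.IsLasVegasColouringOn G) {r : A.Seed}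
    (hr : A.Typical r) : (1 / 5 : ℝ) ^ t ≤ (A.seeds V).real
      {ω | A.history G (mirrored σ (L 0) r ω) t v =
        A.history G (mirrored σ (L 0) r (ω ∘ σ)) t v} := by
  classical
  have : IsProbabilityMeasure (A.seeds V) := by unfold seeds; infer_instance
  let X (ω : V → A.Seed) : List Percept := A.history G (mirrored σ (L 0) r ω) t v
  have hX : Measurable X := (measurable_pi_apply v).comp
    ((measurable_history A G t).comp (measurable_mirrored σ (L 0) r))
  -- The seeds are independent and identically distributed, so permuting the nodes preserves their
  -- law.
  have hcomp : MeasurePreserving (fun ω : V → A.Seed => ω ∘ σ) (A.seeds V) (A.seeds V) := by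
    have := measurePreserving_piCongrLeft (fun _ : V => A.law) σ.symm
    convert! this using 1
    funext ω x
    obtain ⟨y, rfl⟩ := σ.symm.surjective x
    rw [MeasurableEquiv.coe_piCongrLeft, Equiv.piCongrLeft_apply_apply]
    simp
  let f (w : List.Vector Percept t) : ℝ := (A.seeds V).real (X ⁻¹' {w.1})
  have hmeas : ∀ w : List.Vector Percept t, MeasurableSet (X ⁻¹' {w.1}) := fun w =>
    hX (measurableSet_singleton _)
  have hdisj : ∀ w₁ w₂ : List.Vector Percept t, w₁ ≠ w₂ →
      Disjoint (X ⁻¹' {w₁.1}) (X ⁻¹' {w₂.1}) := by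
    intro w₁ w₂ hne
    refine Disjoint.preimage _ ?_
    rw [Set.disjoint_singleton]
    exact fun h => hne (Subtype.ext h)
  have hsum : ∑ w, f w = 1 := by
    rw [← measureReal_iUnion_fintype hdisj hmeas, measureReal_def,
      prob_compl_eq_zero_iff (MeasurableSet.iUnion hmeas) |>.1, ENNReal.toReal_one]
    refine measure_mono_null ?_ (ae_forall_typical (V := V) A)
    intro ω hω hcon
    exact hω (Set.mem_iUnion.2 ⟨⟨X ω, hL.length_history_mirrored hA hr hcon t⟩, rfl⟩)
  -- `X ω` depends on the seeds on `L 0` and `X (ω ∘ σ)` on those on its disjoint mirror image: two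
  -- independent variables with the same law.
  have hprod : ∀ w : List.Vector Percept t,
      (A.seeds V).real (X ⁻¹' {w.1} ∩ (fun ω => ω ∘ σ) ⁻¹' (X ⁻¹' {w.1})) = f w ^ 2 := by
    intro w
    have hdep : ∀ ω ω' : V → A.Seed, (∀ x ∈ L 0, ω x = ω' x) → X ω = X ω' := by
      intro ω ω' h
      have : mirrored σ (L 0) r ω = mirrored σ (L 0) r ω' := by
        funext x
        unfold mirrored
        split_ifs with h1 h2
        exacts [h _ h1, h _ h2, rfl]
      simp only [X, this]
    have := measure_inter_of_disjoint A.law (S := L 0) (T := (L 0).image σ)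
      (E := X ⁻¹' {w.1}) (F := (fun ω => ω ∘ σ) ⁻¹' (X ⁻¹' {w.1}))
      (by
        rw [Finset.disjoint_right]
        intro a ha
        obtain ⟨x, hx, rfl⟩ := Finset.mem_image.1 ha
        exact hL.apply_notMem x hx)
      (hmeas w) (hcomp.measurable (hmeas w))
      (fun ω ω' h hω => (hdep ω ω' h).symm.trans hω)
      (fun ω ω' h hω => (hdep (ω ∘ σ) (ω' ∘ σ) fun x hx =>
        h _ (Finset.mem_image_of_mem σ hx)).symm.trans hω)
    change A.seeds V _ = A.seeds V _ * A.seeds V _ at this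
    rw [hcomp.measure_preimage (hmeas w).nullMeasurableSet] at this
    rw [measureReal_def, this, ENNReal.toReal_mul, sq]
    rfl
  have hle : ∑ w, f w ^ 2 ≤ (A.seeds V).real {ω | X ω = X (ω ∘ σ)} := by
    simp only [← hprod]
    rw [← measureReal_iUnion_fintype]
    · refine measureReal_mono (Set.iUnion_subset fun w ω hω => ?_)
      exact hω.1.trans hω.2.symm
    · exact fun w₁ w₂ hne => (hdisj w₁ w₂ hne).mono Set.inter_subset_left Set.inter_subset_left
    · exact fun w => (hmeas w).inter (hcomp.measurable (hmeas w))
  -- Cauchy–Schwarz: two independent samples from a law on `5 ^ t` points collide with probability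
  -- at least `5⁻ᵗ`.
  have hcs := sq_sum_le_card_mul_sum_sq (s := Finset.univ) (f := f)
  rw [hsum, Finset.card_univ, card_vector, card_percept] at hcs
  refine le_trans ?_ hle
  rw [div_pow, one_pow, div_le_iff₀' (by positivity)]
  push_cast at hcs
  linarith

end IsMirror

/-- Disjoint mirrors of depth `t` make it unlikely that all nodes terminate within `t` slots. -/
theorem probWithin_le_pow [Fintype V] (hA : A.IsLasVegasColouringOn G) {t m : ℕ} {x : ℝ}
    (hx : x < t + 1) {S : ℕ → Finset V} (hS : ∀ i k, i < k → k < m → Disjoint (S i) (S k))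
    (hmirror : ∀ i < m, ∃ v σ L, IsMirror G t v σ L ∧ ∀ x ∈ L 0, x ∈ S i ∧ σ x ∈ S i) :
    A.probWithin G x ≤ (1 - (1 / 5 : ℝ) ^ t) ^ m := by
  classical
  have : IsProbabilityMeasure (A.seeds V) := by unfold seeds; infer_instance
  obtain ⟨r, hr⟩ := (ae_typical A).exists
  -- `F i` is the event that the two sides of the `i`-th mirror disagree; termination of all nodes
  -- within `t` slots almost surely implies every `F i`.
  let F (i : ℕ) : Set (V → A.Seed) := if h : i < m then
      {ω | A.history G (mirrored (hmirror i h).choose_spec.choose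
          ((hmirror i h).choose_spec.choose_spec.choose 0) r ω) t (hmirror i h).choose =
        A.history G (mirrored (hmirror i h).choose_spec.choose
          ((hmirror i h).choose_spec.choose_spec.choose 0) r
          (ω ∘ (hmirror i h).choose_spec.choose)) t (hmirror i h).choose}ᶜ
    else ∅
  have hF : ∀ i < m, ∃ v σ L, IsMirror G t v σ L ∧ (∀ x ∈ L 0, x ∈ S i ∧ σ x ∈ S i) ∧
      F i = {ω | A.history G (mirrored σ (L 0) r ω) t v =
        A.history G (mirrored σ (L 0) r (ω ∘ σ)) t v}ᶜ := by
    intro i hi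
    refine ⟨_, _, _, (hmirror i hi).choose_spec.choose_spec.choose_spec.1,
      (hmirror i hi).choose_spec.choose_spec.choose_spec.2, ?_⟩
    simp only [F, hi, dif_pos]
  have hmeasE : ∀ (v : V) (σ : V ≃ V) (L : Finset V),
      MeasurableSet {ω : V → A.Seed | A.history G (mirrored σ L r ω) t v =
        A.history G (mirrored σ L r (ω ∘ σ)) t v} := by
    intro v σ L
    have h := (measurable_pi_apply v).comp ((measurable_history A G t).comp
      (measurable_mirrored (A := A) σ L r))
    have hσ : Measurable fun ω : V → A.Seed => ω ∘ σ :=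
      measurable_pi_iff.2 fun x => measurable_pi_apply _
    exact measurableSet_eq_fun h (h.comp hσ)
  have hpow := measureReal_biInter_le_pow A.law (q := 1 - (1 / 5 : ℝ) ^ t) m (S := S) (F := F) hS
    (by
      intro i hi
      obtain ⟨v, σ, L, -, -, h⟩ := hF i hi
      rw [h]
      exact (hmeasE v σ (L 0)).compl)
    (by
      intro i hi ω ω' hω
      obtain ⟨v, σ, L, hL, hLS, h⟩ := hF i hi
      have h1 : mirrored σ (L 0) r ω = mirrored σ (L 0) r ω' := by
        funext x
        unfold mirrored
        split_ifs with h1 h2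
        exacts [hω _ (hLS _ h1).1, hω _ (hLS _ h2).1, rfl]
      have h2 : mirrored σ (L 0) r (ω ∘ σ) = mirrored σ (L 0) r (ω' ∘ σ) := by
        funext x
        unfold mirrored
        split_ifs with h1 h2
        exacts [hω _ (hLS _ h1).2, hω _ (hLS _ h2).2, rfl]
      rw [h]
      simp only [Set.mem_compl_iff, Set.mem_ofPred_eq, h1, h2, imp_self])
    (by
      intro i hi
      obtain ⟨v, σ, L, hL, -, h⟩ := hF i hi
      change (A.seeds V).real _ ≤ _
      rw [h, probReal_compl_eq_one_sub (hmeasE v σ (L 0))]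
      linarith [hL.pow_le_measureReal hA hr])
  refine le_trans ?_ hpow
  unfold probWithin
  refine ENNReal.toReal_mono (measure_ne_top _ _) (measure_mono_ae ?_)
  filter_upwards [ae_forall_typical (V := V) A] with ω hω hterm
  obtain ⟨s, hs, hterm⟩ := hterm
  have hst : s ≤ t := by
    have : (s : ℝ) < t + 1 := hs.trans_lt hx
    have : s < t + 1 := by exact_mod_cast this
    omega
  change ω ∈ ⋂ i < m, F i
  simp only [Set.mem_iInter]
  intro i hi
  obtain ⟨v, σ, L, hL, -, h⟩ := hF i hi
  rw [h]
  intro heq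
  obtain ⟨c, hc⟩ := hterm.mono hst v
  exact hL.not_hasColour hA hr hω heq c hc

end Algorithm

end Beeping

namespace Beeping

/-! ### Error terms -/

theorem const_div_sq_isLittleO (K : ℝ) :
    (fun n : ℕ => K / ((n : ℝ) ^ 2 + 1)) =o[atTop] (fun n : ℕ => (n : ℝ)⁻¹) := by
  rw [isLittleO_iff_tendsto' ((eventually_gt_atTop 0).mono fun n hn h => by
    have : (0 : ℝ) < n := by exact_mod_cast hn
    simp at h; omega)]
  have h1 : Tendsto (fun n : ℕ => K / (n : ℝ)) atTop (nhds 0) :=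
    tendsto_const_div_atTop_nhds_zero_nat K
  refine squeeze_zero_norm' ?_ (tendsto_norm_zero.comp h1)
  filter_upwards [eventually_gt_atTop 0] with n hn
  have hn' : (0 : ℝ) < n := by exact_mod_cast hn
  simp only [Function.comp_apply, div_inv_eq_mul, norm_mul, norm_div]
  rw [Real.norm_of_nonneg hn'.le, Real.norm_of_nonneg (by positivity : (0 : ℝ) ≤ (n : ℝ) ^ 2 + 1),
    div_mul_eq_mul_div, div_le_div_iff₀ (by positivity) hn']
  nlinarith [norm_nonneg K]

/-- Many independent events of probability `5⁻ᵗ`, where `t` is logarithmic: one of them occurs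
with high probability. -/
theorem one_sub_pow_le {n t m : ℕ} (hn : 1 ≤ n) (ht : (t : ℝ) ≤ Real.logb 2 n / 8)
    (hm : n ≤ 4 * (t + 1) * (m + 1)) :
    (1 - (1 / 5 : ℝ) ^ t) ^ m ≤ 40000 / ((n : ℝ) ^ 2 + 1) := by
  have hn' : (1 : ℝ) ≤ n := by exact_mod_cast hn
  have hn0 : (0 : ℝ) < n := by linarith
  have h16 : (16 : ℝ) ^ t ≤ √n := by
    refine Real.le_sqrt_of_sq_le ?_
    have h8 : ((8 * t : ℕ) : ℝ) ≤ Real.logb 2 n := by push_cast; linarith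
    rw [Real.le_logb_iff_rpow_le (by norm_num) hn0, Real.rpow_natCast, pow_mul] at h8
    calc ((16 : ℝ) ^ t) ^ 2 = ((2 : ℝ) ^ 8) ^ t := by rw [← pow_mul, mul_comm, pow_mul]; norm_num
      _ ≤ (n : ℝ) := h8
  have ht2 : (t + 1 : ℝ) ≤ 2 ^ t := by
    exact_mod_cast Nat.succ_le_of_lt (Nat.lt_two_pow_self (n := t))
  have hmR : (n : ℝ) ≤ 4 * (t + 1) * (m + 1) := by exact_mod_cast hm
  have hs : 0 < √(n : ℝ) := Real.sqrt_pos.2 hn0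
  have hss : √(n : ℝ) * √n = n := Real.mul_self_sqrt hn0.le
  have h5 : (5 : ℝ) ^ t * 2 ^ t ≤ 16 ^ t := by
    rw [← mul_pow]; exact pow_le_pow_left₀ (by norm_num) (by norm_num) t
  -- `5 ^ t * (t + 1) ≤ 10 ^ t ≤ 16 ^ t ≤ √n`, while `(m + 1) * (t + 1) ≥ n / 4`.
  have hkey : √n / 4 ≤ (m + 1) * (1 / 5 : ℝ) ^ t := by
    rw [div_pow, one_pow, mul_one_div, div_le_div_iff₀ (by norm_num) (by positivity)]
    have h1 : √(n : ℝ) * (5 ^ t * 2 ^ t) ≤ n := by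
      calc _ ≤ √(n : ℝ) * √n := mul_le_mul_of_nonneg_left (h5.trans h16) hs.le
        _ = n := hss
    have h2 : (n : ℝ) ≤ (m + 1) * 4 * 2 ^ t := by
      refine hmR.trans ?_
      have : (0 : ℝ) ≤ m + 1 := by positivity
      nlinarith
    have h3 : (0 : ℝ) < 2 ^ t := by positivity
    refine le_of_mul_le_mul_right ?_ h3
    calc √(n : ℝ) * 5 ^ t * 2 ^ t = √(n : ℝ) * (5 ^ t * 2 ^ t) := by ring
      _ ≤ _ := h1.trans h2
  have hp : (1 / 5 : ℝ) ^ t ≤ 1 := pow_le_one₀ (by norm_num) (by norm_num)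
  have hexp : (1 - (1 / 5 : ℝ) ^ t) ^ m ≤ Real.exp 1 * Real.exp (-(√n / 4)) := by
    calc (1 - (1 / 5 : ℝ) ^ t) ^ m ≤ Real.exp (-(1 / 5 : ℝ) ^ t) ^ m :=
          pow_le_pow_left₀ (by linarith) (Real.one_sub_le_exp_neg _) m
      _ = Real.exp (m * -(1 / 5 : ℝ) ^ t) := (Real.exp_nat_mul _ m).symm
      _ ≤ Real.exp (1 + -(√n / 4)) := Real.exp_le_exp.2 (by linarith)
      _ = _ := Real.exp_add _ _
  -- The fourth term of the exponential series gives `exp (√n / 4) ≥ n ^ 2 / 6144`. The constant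
  -- 40000 exceeds `2 * 3 * 6144`, with `3 > e` accounting for the passage from `m + 1` to `m` and
  -- `2` for that from `n ^ 2` to `n ^ 2 + 1`.
  have hfact := Real.pow_div_factorial_le_exp (√n / 4) (by positivity) 4
  have h4 : (√(n : ℝ) / 4) ^ 4 / (Nat.factorial 4 : ℝ) = (n : ℝ) ^ 2 / 6144 := by
    have : √(n : ℝ) ^ 4 = (n : ℝ) ^ 2 := by
      calc √(n : ℝ) ^ 4 = (√n * √n) ^ 2 := by ring
        _ = _ := by rw [hss]
    rw [div_pow, this, show Nat.factorial 4 = 24 from rfl]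
    push_cast
    ring
  rw [h4] at hfact
  refine hexp.trans ?_
  rw [Real.exp_neg, ← div_eq_mul_inv, div_le_div_iff₀ (Real.exp_pos _) (by positivity)]
  have he := Real.exp_one_lt_three
  have hn2 : 1 ≤ (n : ℝ) ^ 2 := one_le_pow₀ hn'
  nlinarith

namespace Algorithm

variable {A : Algorithm}

theorem probWithin_le_one {V : Type} [Fintype V] (G : SimpleGraph V) (x : ℝ) :
    A.probWithin G x ≤ 1 := by
  have : IsProbabilityMeasure (A.seeds V) := by unfold seeds; infer_instance
  exact measureReal_le_one

/-! ### Rings -/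

theorem val_of_cycleGraph_adj {n : ℕ} {x y : Fin n} (h : (SimpleGraph.cycleGraph n).Adj x y) :
    x.val = y.val + 1 ∨ y.val = x.val + 1 ∨ (x.val = 0 ∧ y.val + 1 = n) ∨
      (y.val = 0 ∧ x.val + 1 = n) := by
  rw [SimpleGraph.cycleGraph_adj'] at h
  have hx := x.isLt
  have hy := y.isLt
  rcases h with h | h
  · rcases le_or_gt y x with hle | hlt
    · rw [Fin.coe_sub_iff_le.2 hle] at h; omega
    · rw [Fin.coe_sub_iff_lt.2 hlt] at h; omega
  · rcases le_or_gt x y with hle | hlt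
    · rw [Fin.coe_sub_iff_le.2 hle] at h; omega
    · rw [Fin.coe_sub_iff_lt.2 hlt] at h; omega

/-- The mirror is a reflection of the ring. Influence travels one node per slot, so the protected
arc loses its outermost node in each slot, and `t + 1` nodes on either side of the edge suffice. -/
theorem exists_isMirror_cycleGraph {n t a : ℕ} (h : a + (2 * t + 2) ≤ n) :
    ∃ v σ L, IsMirror (SimpleGraph.cycleGraph n) t v σ L ∧ ∀ x ∈ L 0,
      (a ≤ x.val ∧ x.val < a + (2 * t + 2)) ∧
      (a ≤ (σ x).val ∧ (σ x).val < a + (2 * t + 2)) := by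
  have : NeZero n := ⟨by omega⟩
  let v : Fin n := ⟨a + t, by omega⟩
  let v' : Fin n := ⟨a + t + 1, by omega⟩
  let σ : Fin n ≃ Fin n := Equiv.subLeft (v + v')
  let L (s : ℕ) : Finset (Fin n) := Finset.univ.filter fun x => a + s ≤ x.val ∧ x.val ≤ a + t
  have hσ : ∀ x : Fin n, x ∈ L 0 → (σ x).val = 2 * (a + t) + 1 - x.val := by
    intro x hx
    simp only [L, Finset.mem_filter, Finset.mem_univ, true_and] at hx
    let y : Fin n := ⟨2 * (a + t) + 1 - x.val, by omega⟩
    have : σ x = y := by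
      change v + v' - x = y
      rw [sub_eq_iff_eq_add]
      ext
      simp only [Fin.val_add, v, v', y]
      congr 1
      omega
    rw [this]
  have hv : σ v = v' := by
    change v + v' - v = v'
    abel
  have hadj : (SimpleGraph.cycleGraph n).Adj v v' := by
    rw [SimpleGraph.cycleGraph_adj']
    right
    rw [Fin.coe_sub_iff_le.2 (by simp [v, v'])]
    simp [v, v']
  refine ⟨v, σ, L, ⟨?_, ?_, ?_, ?_, ?_, ?_, ?_⟩, ?_⟩
  · intro x
    change v + v' - (v + v' - x) = x
    abel
  · intro x y
    rw [SimpleGraph.cycleGraph_adj', SimpleGraph.cycleGraph_adj']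
    change (v + v' - x - (v + v' - y)).val = 1 ∨ (v + v' - y - (v + v' - x)).val = 1 ↔ _
    rw [sub_sub_sub_cancel_left, sub_sub_sub_cancel_left, or_comm]
  · rwa [hv]
  · simp [L, v]
  · intro s s' hs x hx
    simp only [L, Finset.mem_filter, Finset.mem_univ, true_and] at hx ⊢
    omega
  · intro s x y hx hxy
    simp only [L, Finset.mem_filter, Finset.mem_univ, true_and] at hx ⊢
    have hval := val_of_cycleGraph_adj hxy
    rw [hv, Fin.ext_iff, Fin.ext_iff]
    simp only [v, v']
    omega
  · intro x hx hx'
    have h1 := hσ x hx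
    simp only [L, Finset.mem_filter, Finset.mem_univ, true_and] at hx hx'
    omega
  · intro x hx
    rw [hσ x hx]
    simp only [L, Finset.mem_filter, Finset.mem_univ, true_and] at hx
    omega

theorem probWithin_cycleGraph_le (n : ℕ)
    (hA : A.IsLasVegasColouringOn (SimpleGraph.cycleGraph n)) :
    A.probWithin (SimpleGraph.cycleGraph n) (1 / 8 * Real.logb 2 n) ≤
      40000 / ((n : ℝ) ^ 2 + 1) := by
  rcases Nat.eq_zero_or_pos n with rfl | hn
  · refine (probWithin_le_one _ _).trans ?_
    norm_num
  set t := ⌊Real.logb 2 n / 8⌋₊ with ht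
  have hlog : 0 ≤ Real.logb 2 n :=
    Real.logb_nonneg (by norm_num) (by exact_mod_cast hn)
  refine le_trans ?_ (one_sub_pow_le (m := n / (2 * t + 2)) hn
    (Nat.floor_le (by positivity)) ?_)
  · refine probWithin_le_pow hA (S := fun i => Finset.univ.filter fun x : Fin n =>
      i * (2 * t + 2) ≤ x.val ∧ x.val < i * (2 * t + 2) + (2 * t + 2)) ?_ ?_ ?_
    · have := Nat.lt_floor_add_one (Real.logb 2 n / 8)
      rw [← ht] at this
      linarith
    · intro i k hik _
      rw [Finset.disjoint_left]
      intro x hx hx'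
      simp only [Finset.mem_filter, Finset.mem_univ, true_and] at hx hx'
      have : (i + 1) * (2 * t + 2) ≤ k * (2 * t + 2) := Nat.mul_le_mul_right _ hik
      rw [add_mul, one_mul] at this
      omega
    · intro i hi
      have h1 : (i + 1) * (2 * t + 2) ≤ n :=
        (Nat.mul_le_mul_right _ hi).trans (Nat.div_mul_le_self _ _)
      rw [add_mul, one_mul] at h1
      simpa using exists_isMirror_cycleGraph h1
  · have := Nat.lt_mul_div_succ n (show 0 < 2 * t + 2 by omega)
    nlinarith

/-! ### A clique and disjoint edges -/

/-- The index of the clique of a node: the first clique consists of `d + 1` nodes, the others of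
two nodes. -/
def block (d x : ℕ) : ℕ := if x ≤ d then 0 else (x - d - 1) / 2 + 1

/-- The disjoint union of a clique of `d + 1` nodes and of as many edges as possible. -/
def blockGraph (n d : ℕ) : SimpleGraph (Fin n) where
  Adj x y := x ≠ y ∧ block d x = block d y
  symm := ⟨fun _ _ h => ⟨h.1.symm, h.2.symm⟩⟩
  loopless := ⟨fun _ h => h.1 rfl⟩

theorem maxDegree_blockGraph {n d : ℕ} (hd : 1 ≤ d) (hdn : d < n)
    [DecidableRel (blockGraph n d).Adj] : (blockGraph n d).maxDegree = d := by
  refine le_antisymm (SimpleGraph.maxDegree_le_of_forall_degree_le _ _ fun x => ?_) ?_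
  · rw [← SimpleGraph.card_neighborFinset_eq_degree]
    have hmem : ∀ y ∈ (blockGraph n d).neighborFinset x,
        x.val ≠ y.val ∧ block d x = block d y := by
      intro y hy
      rw [SimpleGraph.mem_neighborFinset] at hy
      exact ⟨fun h => hy.1 (Fin.ext h), hy.2⟩
    by_cases hx : x.val ≤ d
    · have : ((Finset.range (d + 1)).erase x.val).card = d := by
        rw [Finset.card_erase_of_mem (by simpa using Nat.lt_succ_of_le hx), Finset.card_range]
        rfl
      refine le_of_le_of_eq ?_ this
      refine Finset.card_le_card_of_injOn Fin.val (fun y hy => ?_) (Fin.val_injective.injOn)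
      obtain ⟨h1, h2⟩ := hmem y hy
      simp only [block, hx, if_true] at h2
      simp only [Finset.coe_erase, Finset.coe_range, Set.mem_sdiff, Set.mem_Iio,
        Set.mem_singleton_iff]
      split_ifs at h2
      omega
    · refine le_trans (Finset.card_le_one.2 fun y hy z hz => ?_) hd
      obtain ⟨h1, h1'⟩ := hmem y hy
      obtain ⟨h2, h2'⟩ := hmem z hz
      simp only [block, hx, if_false] at h1' h2'
      ext
      split_ifs at h1'
      split_ifs at h2'
      omega
  · have h0 : 0 < n := by omega
    refine le_trans ?_ (SimpleGraph.degree_le_maxDegree _ (⟨0, h0⟩ : Fin n))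
    rw [← SimpleGraph.card_neighborFinset_eq_degree]
    let f (i : Fin d) : Fin n := ⟨i.val + 1, by omega⟩
    have hf : Function.Injective f := by
      intro i j hij
      simpa [f, Fin.ext_iff] using hij
    have hcard : (Finset.univ.image f).card = d := by
      rw [Finset.card_image_of_injective _ hf, Finset.card_univ, Fintype.card_fin]
    refine hcard.symm.trans_le (Finset.card_le_card fun y hy => ?_)
    obtain ⟨i, -, rfl⟩ := Finset.mem_image.1 hy
    rw [SimpleGraph.mem_neighborFinset]
    refine ⟨by simp [f, Fin.ext_iff], ?_⟩
    have := i.isLt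
    simp only [block, f]
    split_ifs <;> omega

/-- An isolated edge is a mirror of every depth: nothing reaches it from outside, so `L` may be
constant. -/
theorem exists_isMirror_blockGraph {n d i : ℕ} (t : ℕ) (h : d + 2 * i + 2 < n) :
    ∃ v σ L, IsMirror (blockGraph n d) t v σ L ∧ ∀ x ∈ L 0,
      block d x = i + 1 ∧ block d (σ x) = i + 1 := by
  let v : Fin n := ⟨d + 2 * i + 1, by omega⟩
  let v' : Fin n := ⟨d + 2 * i + 2, by omega⟩
  have hb : block d v = i + 1 := by simp only [block, v]; split_ifs <;> omega
  have hb' : block d v' = i + 1 := by simp only [block, v']; split_ifs <;> omega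
  have hne : v ≠ v' := by simp [v, v', Fin.ext_iff]
  have hblock : ∀ x, block d (Equiv.swap v v' x) = block d x := by
    intro x
    rw [Equiv.swap_apply_def]
    split_ifs with h1 h2
    · rw [h1, hb, hb']
    · rw [h2, hb, hb']
    · rfl
  refine ⟨v, Equiv.swap v v', fun _ => {v}, ⟨?_, ?_, ?_, ?_, ?_, ?_, ?_⟩, ?_⟩
  · simp
  · intro x y
    simp [blockGraph, hblock]
  · rw [Equiv.swap_apply_left]
    exact ⟨hne, hb.trans hb'.symm⟩
  · simp
  · exact antitone_const
  · intro s x y hx hxy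
    rw [Finset.mem_singleton] at hx
    rw [hx] at hxy
    refine Or.inr ⟨hx, ?_⟩
    rw [Equiv.swap_apply_left]
    have h1 : d + 2 * i + 1 ≠ y.val := fun h => hxy.1 (Fin.ext h)
    have h2 : block d v = block d y := hxy.2
    rw [hb] at h2
    simp only [block] at h2
    ext
    change y.val = d + 2 * i + 2
    split_ifs at h2
    omega
  · simp [hne.symm]
  · simp [hb, hb']

/-- If `log n ≤ d`, the clique alone forces `d + 1` slots. If `d < log n`, the edges serve as
mirrors of depth about `(log n) / 8`. The twin argument changes the network, hence the correctness
assumption on all networks. -/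
theorem probWithin_blockGraph_le {n d : ℕ} (hdn : d < n) (hA : A.IsLasVegasColouring) :
    A.probWithin (blockGraph n d) (1 / 16 * ((d : ℝ) + Real.logb 2 n)) ≤
      40000 / ((n : ℝ) ^ 2 + 1) := by
  have hn1 : 1 ≤ n := by omega
  have hlog : 0 ≤ Real.logb 2 n :=
    Real.logb_nonneg (by norm_num) (by exact_mod_cast hn1)
  rcases le_or_gt (Real.logb 2 n) d with hle | hlt
  · have hzero : A.seeds (Fin n) {ω | ∃ t : ℕ,
        (t : ℝ) ≤ 1 / 16 * ((d : ℝ) + Real.logb 2 n) ∧ A.TerminatedBy (blockGraph n d) ω t} = 0 := by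
      refine measure_mono_null ?_ (ae_forall_typical (V := Fin n) A)
      rintro ω ⟨t, ht, hterm⟩ hω
      have hcard := card_le_of_terminatedBy (s := Finset.univ.filter fun x : Fin n => x.val ≤ d)
        (G := blockGraph n d) (fun x y z hxy hyz hxz => ⟨hxz, hxy.2.trans hyz.2⟩) (fun v => hA _ _) hω hterm
        (by
          intro x hx y hy hxy
          simp only [Finset.mem_filter, Finset.mem_univ, true_and] at hx hy
          exact ⟨hxy, by simp [block, hx, hy]⟩)
      have hset : (Finset.univ.filter fun x : Fin n => x.val ≤ d) = Finset.Iic ⟨d, hdn⟩ := by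
        ext x
        simp [Fin.le_def]
      rw [hset, Fin.card_Iic] at hcard
      have : ((d + 1 : ℕ) : ℝ) ≤ t := by exact_mod_cast hcard
      push_cast at this
      linarith
    unfold probWithin
    rw [measureReal_def, hzero]
    simp only [ENNReal.toReal_zero]
    positivity
  · rcases lt_or_ge n 16 with hn | hn
    · refine (probWithin_le_one _ _).trans ?_
      rw [one_le_div (by positivity)]
      have : (n : ℝ) ≤ 16 := by exact_mod_cast hn.le
      nlinarith [Nat.cast_nonneg (α := ℝ) n]
    · set t := ⌊Real.logb 2 n / 8⌋₊ with ht
      refine le_trans ?_ (one_sub_pow_le (m := (n - d - 1) / 2) hn1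
        (Nat.floor_le (by positivity)) ?_)
      · refine probWithin_le_pow (hA _ _) (t := t)
          (S := fun i => Finset.univ.filter fun x : Fin n => block d x = i + 1) ?_ ?_ ?_
        · have := Nat.lt_floor_add_one (Real.logb 2 n / 8)
          rw [← ht] at this
          linarith
        · intro i k hik _
          rw [Finset.disjoint_left]
          intro x hx hx'
          simp only [Finset.mem_filter, Finset.mem_univ, true_and] at hx hx'
          omega
        · intro i hi
          simpa using exists_isMirror_blockGraph t (by omega)
      -- As `d < log n` and `n ≥ 16`, the clique occupies at most about half of the nodes, which
      -- leaves order `n` edges.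
      · have h2 : 2 ^ d < n := by
          have := (Real.lt_logb_iff_rpow_lt (by norm_num) (by positivity)).1 hlt
          rw [Real.rpow_natCast] at this
          exact_mod_cast this
        have h3 : 2 * d + 2 ≤ n := by
          rcases lt_or_ge d 3 with h | h
          · omega
          · have : ∀ d, 3 ≤ d → 2 * d + 2 ≤ 2 ^ d := by
              intro d hd
              induction d, hd using Nat.le_induction with
              | base => norm_num
              | succ d _ ih => rw [pow_succ]; omega
            have := this d h
            omega
        have h4 : n ≤ 4 * ((n - d - 1) / 2 + 1) := by omega
        calc n ≤ 4 * ((n - d - 1) / 2 + 1) := h4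
          _ ≤ 4 * (t + 1) * ((n - d - 1) / 2 + 1) := by
            refine Nat.mul_le_mul_right _ ?_
            omega

end Algorithm

end Beeping

namespace Beeping

/-! ### An adaptive colouring algorithm -/

/-- Whether a percept reveals a beeping neighbour. -/
def Percept.heard : Percept → Bool
  | .beepedAlone => false
  | .silence => false
  | _ => true

theorem heard_perceive (b : Bool) (n : ℕ) : (perceive b n).heard = true ↔ n ≠ 0 := by
  match b, n with
  | true, 0 => simp [perceive, Percept.heard]
  | true, _ + 1 => simp [perceive, Percept.heard]
  | false, 0 => simp [perceive, Percept.heard]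
  | false, 1 => simp [perceive, Percept.heard]
  | false, _ + 2 => simp [perceive, Percept.heard]

theorem perceive_eq_beepedAlone (b : Bool) (n : ℕ) :
    perceive b n = .beepedAlone ↔ b = true ∧ n = 0 := by
  match b, n with
  | true, 0 => simp [perceive]
  | true, _ + 1 => simp [perceive]
  | false, 0 => simp [perceive]
  | false, 1 => simp [perceive]
  | false, _ + 2 => simp [perceive]

/-- The level of a node increases when it hears a beep and decreases otherwise. -/
def level : List Percept → ℕ
  | [] => 0
  | p :: l => if p.heard then level l + 1 else level l - 1

/-- The status of a node is its level, or `none` if it has beeped alone in the latest slot. -/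
def status : List Percept → Option ℕ
  | [] => some 0
  | .beepedAlone :: _ => none
  | p :: l => some (level (p :: l))

theorem status_eq_some {l : List Percept} {j : ℕ} (h : status l = some j) : j = level l := by
  match l with
  | [] => simpa [status, level] using h.symm
  | .beepedAlone :: _ => simp [status] at h
  | .beepedWithOthers :: _ => simpa [status] using h.symm
  | .silence :: _ => simpa [status] using h.symm
  | .oneBeep :: _ => simpa [status] using h.symm
  | .severalBeeps :: _ => simpa [status] using h.symm

theorem status_cons {p : Percept} {l : List Percept} (h : p ≠ .beepedAlone) :
    status (p :: l) = some (level (p :: l)) := by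
  cases p <;> first | rfl | exact absurd rfl h

theorem status_cons_eq_none {p : Percept} {l : List Percept} :
    status (p :: l) = none ↔ p = .beepedAlone := by
  cases p <;> simp [status]

/-- The probability to beep. -/
noncomputable def beepProb : Option ℕ → ℝ
  | none => 0
  | some j => (1 / 2) ^ (j + 1)

theorem beepProb_nonneg (s : Option ℕ) : 0 ≤ beepProb s := by
  cases s <;> simp [beepProb]

theorem beepProb_le_half (s : Option ℕ) : beepProb s ≤ 1 / 2 := by
  cases s with
  | none => simp [beepProb]
  | some j =>
    simp only [beepProb, pow_succ]
    have : (1 / 2 : ℝ) ^ j ≤ 1 := pow_le_one₀ (by norm_num) (by norm_num)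
    linarith

open Classical in
/-- Nodes beep with a probability that is halved whenever a neighbour beeps and doubled otherwise;
a node that beeps alone terminates with the current time as its colour. -/
noncomputable def adaptiveColouring : Algorithm where
  Seed := ℕ → unitInterval
  law := Measure.infinitePi fun _ => volume
  act r l := match status l with
    | none => .halt l.length
    -- For an active node `l.length` is the number of the slot, so each slot uses a fresh random
    -- number.
    | some j => if (r l.length : ℝ) < (1 / 2) ^ (j + 1) then .beep else .listen
  measurableSet_act l a := by
    cases status l with
    | none => simp
    | some j =>
      have hm : MeasurableSet {r : ℕ → unitInterval | (r l.length : ℝ) < (1 / 2) ^ (j + 1)} :=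
        measurableSet_lt (measurable_subtype_coe.comp (measurable_pi_apply _)) measurable_const
      have : Measurable fun r : ℕ → unitInterval =>
          if (r l.length : ℝ) < (1 / 2) ^ (j + 1) then Action.beep else Action.listen :=
        Measurable.ite hm measurable_const measurable_const
      exact this (measurableSet_singleton a)

namespace adaptiveColouring

variable {V : Type} {G : SimpleGraph V} {ω : V → adaptiveColouring.Seed}

theorem act_eq_halt {r : adaptiveColouring.Seed} {l : List Percept} {c : ℕ} :
    adaptiveColouring.act r l = .halt c ↔ status l = none ∧ l.length = c := by
  simp only [adaptiveColouring]
  cases status l with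
  | none => simp
  | some j => simp; split_ifs <;> simp

theorem act_eq_beep {r : ℕ → unitInterval} {l : List Percept} :
    adaptiveColouring.act r l = .beep ↔ (r l.length : ℝ) < beepProb (status l) := by
  simp only [adaptiveColouring, beepProb]
  cases status l with
  | none => simpa using unitInterval.nonneg _
  | some j => simp

theorem length_history {t : ℕ} {v : V}
    (h : status (adaptiveColouring.history G ω t v) ≠ none) :
    (adaptiveColouring.history G ω t v).length = t := by
  induction t with
  | zero => rfl
  | succ t ih =>
    cases hact : adaptiveColouring.act (ω v) (adaptiveColouring.history G ω t v) with
    | halt c =>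
      rw [Algorithm.history_succ_of_halt hact] at h
      exact absurd (act_eq_halt.1 hact).1 h
    | beep =>
      have hs : status (adaptiveColouring.history G ω t v) ≠ none := by
        intro hs
        rw [act_eq_halt.2 ⟨hs, rfl⟩] at hact
        cases hact
      rw [Algorithm.history_succ_of_beep hact, List.length_cons, ih hs]
    | listen =>
      have hs : status (adaptiveColouring.history G ω t v) ≠ none := by
        intro hs
        rw [act_eq_halt.2 ⟨hs, rfl⟩] at hact
        cases hact
      rw [Algorithm.history_succ_of_listen hact, List.length_cons, ih hs]

theorem terminatedBy_iff {t : ℕ} : adaptiveColouring.TerminatedBy G ω t ↔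
    ∀ v, status (adaptiveColouring.history G ω t v) = none := by
  refine forall_congr' fun v => ?_
  simp [Algorithm.HasColour, act_eq_halt]

/-- A node with colour `s + 1` has beeped alone in slot `s`. -/
theorem exists_beep_of_hasColour {t c : ℕ} {v : V}
    (h : adaptiveColouring.HasColour G ω t v c) :
    ∃ s, c = s + 1 ∧
      adaptiveColouring.act (ω v) (adaptiveColouring.history G ω s v) = .beep ∧
      adaptiveColouring.beeps G ω s v = 0 := by
  induction t with
  | zero =>
    have := (act_eq_halt.1 h).1
    simp [Algorithm.history, status] at this
  | succ t ih =>
    by_cases ht : ∃ c', adaptiveColouring.HasColour G ω t v c'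
    · obtain ⟨c', ht⟩ := ht
      have : c = c' := by
        have h1 := ht.succ
        unfold Algorithm.HasColour at h1 h
        rw [h] at h1
        exact (Action.halt.inj h1)
      exact ih (this ▸ ht)
    · have hs : status (adaptiveColouring.history G ω t v) ≠ none := fun hs =>
        ht ⟨_, act_eq_halt.2 ⟨hs, rfl⟩⟩
      have hlen := length_history hs
      obtain ⟨h1, h2⟩ := act_eq_halt.1 h
      cases hact : adaptiveColouring.act (ω v) (adaptiveColouring.history G ω t v) with
      | halt c' => exact absurd ⟨c', hact⟩ ht
      | beep =>
        rw [Algorithm.history_succ_of_beep hact] at h1 h2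
        rw [status_cons_eq_none, perceive_eq_beepedAlone] at h1
        rw [List.length_cons, hlen] at h2
        exact ⟨t, h2.symm, hact, h1.2⟩
      | listen =>
        rw [Algorithm.history_succ_of_listen hact] at h1
        rw [status_cons_eq_none, perceive_eq_beepedAlone] at h1
        cases h1.1

/-- A colour records the slot of a solitary beep; neighbours with equal colours would have beeped in
the same slot, so neither alone. No probability is involved. -/
theorem isProper [Finite V] (G : SimpleGraph V) (ω : V → adaptiveColouring.Seed) :
    adaptiveColouring.IsProper G ω := by
  rintro u v huv t c ⟨hu, hv⟩
  obtain ⟨s, rfl, -, h0⟩ := exists_beep_of_hasColour hu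
  obtain ⟨s', hs', hbeep, -⟩ := exists_beep_of_hasColour hv
  obtain rfl : s = s' := by omega
  unfold Algorithm.beeps at h0
  rw [Set.ncard_eq_zero (Set.toFinite _)] at h0
  have : v ∈ {w | G.Adj u w ∧
      adaptiveColouring.act (ω w) (adaptiveColouring.history G ω s w) = .beep} := ⟨huv, hbeep⟩
  rw [h0] at this
  exact this

/-- Whether `v` hears a beep if `b` tells who beeps. -/
def Hears (G : SimpleGraph V) (b : V → Bool) (v : V) : Prop := ∃ u, G.Adj v u ∧ b u = true

open Classical in
/-- The status of all nodes after a slot, given the status before the slot and who beeps. -/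
noncomputable def next (G : SimpleGraph V) (s : V → Option ℕ) (b : V → Bool) (v : V) : Option ℕ :=
  match s v with
  | none => none
  | some j => if Hears G b v then some (j + 1) else if b v then none else some (j - 1)

/-- The status of all nodes after `t` slots. -/
noncomputable def state (G : SimpleGraph V) (t : ℕ) (ω : V → ℕ → unitInterval) (v : V) :
    Option ℕ := status (adaptiveColouring.history G ω t v)

open Classical in
/-- The beeping nodes, given the status and the random numbers of all nodes. -/
noncomputable def beeping (s : V → Option ℕ) (ξ : V → unitInterval) (v : V) : Bool :=
  decide ((ξ v : ℝ) < beepProb (s v))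

open Classical in
-- This turns the execution into a Markov chain on the statuses, driven by fresh random numbers.
theorem state_succ [Finite V] (G : SimpleGraph V) (t : ℕ) (ω : V → ℕ → unitInterval) :
    state G (t + 1) ω = next G (state G t ω) (beeping (state G t ω) fun v => ω v t) := by
  have hb : ∀ v, adaptiveColouring.act (ω v) (adaptiveColouring.history G ω t v) = .beep ↔
      beeping (state G t ω) (fun v => ω v t) v = true := by
    intro v
    rw [act_eq_beep]
    unfold beeping state
    rw [decide_eq_true_iff]
    -- A terminated node's history may be shorter than `t`, so it may point to another random
    -- number; this is harmless because its beeping probability is zero.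
    by_cases hs : status (adaptiveColouring.history G ω t v) = none
    · simp only [hs, beepProb]
      exact iff_of_false (not_lt.2 (unitInterval.nonneg _)) (not_lt.2 (unitInterval.nonneg _))
    · rw [length_history hs]
  have hhears : ∀ v, adaptiveColouring.beeps G ω t v ≠ 0 ↔
      Hears G (beeping (state G t ω) fun v => ω v t) v := by
    intro v
    unfold Algorithm.beeps Hears
    rw [Ne, Set.ncard_eq_zero (Set.toFinite _), ← Ne, ← Set.nonempty_iff_ne_empty]
    exact exists_congr fun u => and_congr_right fun _ => hb u
  funext v
  cases hs : state G t ω v with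
  | none =>
    have hact := act_eq_halt (r := ω v).2 ⟨hs, rfl⟩
    simp only [next, hs]
    unfold state at hs ⊢
    rw [Algorithm.history_succ_of_halt hact, hs]
  | some j =>
    have hj := status_eq_some hs
    simp only [next, hs]
    have key : ∀ b, adaptiveColouring.history G ω (t + 1) v =
        perceive b (adaptiveColouring.beeps G ω t v) :: adaptiveColouring.history G ω t v →
        beeping (state G t ω) (fun v => ω v t) v = b →
        state G (t + 1) ω v =
          if Hears G (beeping (state G t ω) fun v => ω v t) v then some (j + 1)
          else if beeping (state G t ω) (fun v => ω v t) v then none else some (j - 1) := by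
      intro b h hbv
      unfold state at hs ⊢
      rw [h]
      change _ = if Hears G (beeping (state G t ω) fun v => ω v t) v then some (j + 1)
          else if beeping (state G t ω) (fun v => ω v t) v then none else some (j - 1)
      rw [hbv]
      by_cases hh : Hears G (beeping (state G t ω) fun v => ω v t) v
      · have hn := (hhears v).2 hh
        rw [if_pos hh, status_cons (by rw [Ne, perceive_eq_beepedAlone]; tauto), level,
          if_pos ((heard_perceive _ _).2 hn), hj]
      · have hn : adaptiveColouring.beeps G ω t v = 0 := by
          by_contra hn
          exact hh ((hhears v).1 hn)
        rw [if_neg hh]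
        cases b with
        | true => simp [status_cons_eq_none, perceive_eq_beepedAlone, hn]
        | false =>
          rw [status_cons (by rw [Ne, perceive_eq_beepedAlone]; simp), level,
            if_neg (by rw [heard_perceive]; simpa using hn), hj]
          simp
    cases hact : adaptiveColouring.act (ω v) (adaptiveColouring.history G ω t v) with
    | halt c =>
      have := (act_eq_halt.1 hact).1
      unfold state at hs
      rw [this] at hs
      cases hs
    | beep => exact key true (Algorithm.history_succ_of_beep hact) ((hb v).1 hact)
    | listen =>
      refine key false (Algorithm.history_succ_of_listen hact) ?_
      rw [Bool.eq_false_iff, Ne, ← hb, hact]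
      simp

end adaptiveColouring

end Beeping

namespace Beeping
namespace adaptiveColouring

variable {V : Type} {G : SimpleGraph V} {s : V → Option ℕ} {v : V} {b : V → Bool}

/-! ### The drift of the potential -/

open Classical in
/-- An upper bound for the change of the level `j` of `v` in the next slot. -/
noncomputable def levelChange (G : SimpleGraph V) (j : ℕ) (v : V) (b : V → Bool) : ℝ :=
  -- At level 0 a drop is credited when `v` beeps unheard-of by others, that is, when it terminates.
  -- No surviving level is affected, and the drift stays negative at level 0.
  if Hears G b v then 1 else if b v = true ∨ j ≠ 0 then -1 else 0

theorem abs_levelChange_le (j : ℕ) (v : V) (b : V → Bool) : |levelChange G j v b| ≤ 1 := by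
  unfold levelChange
  split_ifs <;> simp

theorem level_le {j j' : ℕ} (hj : s v = some j) (hj' : next G s b v = some j') :
    (j' : ℝ) ≤ j + levelChange G j v b := by
  simp only [next, hj] at hj'
  unfold levelChange
  split_ifs at hj' ⊢ with h1 h2 h3 h3
  · obtain rfl := Option.some.inj hj'
    push_cast
    linarith
  · obtain rfl := Option.some.inj hj'
    have : j ≠ 0 := by tauto
    rw [Nat.cast_pred (Nat.pos_of_ne_zero this)]
    linarith
  · obtain rfl := Option.some.inj hj'
    have : j = 0 := by tauto
    simp [this]

variable [Fintype V]

open Classical in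
/-- The sum of the beeping probabilities of the neighbours of `v`. -/
noncomputable def mass (G : SimpleGraph V) (s : V → Option ℕ) (v : V) : ℝ :=
  ∑ u with G.Adj v u, beepProb (s u)

open Classical in
/-- The number of neighbours of `v` that have not terminated. -/
noncomputable def activeNeighbours (G : SimpleGraph V) (s : V → Option ℕ) (v : V) : ℕ :=
  (Finset.univ.filter fun u => G.Adj v u ∧ s u ≠ none).card

open Classical in
/-- An upper bound for the mass after the next slot. -/
noncomputable def massBound (G : SimpleGraph V) (s : V → Option ℕ) (v : V) (b : V → Bool) : ℝ :=
  ∑ u with G.Adj v u, beepProb (s u) * (if Hears G b u then 1 / 2 else 2)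

/-- A neighbour of `v` terminates in the next slot. -/
def NeighbourHalts (G : SimpleGraph V) (s : V → Option ℕ) (v : V) (b : V → Bool) : Prop :=
  ∃ u, G.Adj v u ∧ s u ≠ none ∧ b u = true ∧ ¬ Hears G b u

theorem mass_nonneg (G : SimpleGraph V) (s : V → Option ℕ) (v : V) : 0 ≤ mass G s v :=
  Finset.sum_nonneg fun _ _ => beepProb_nonneg _

theorem mass_next_le : mass G (next G s b) v ≤ massBound G s v b := by
  classical
  refine Finset.sum_le_sum fun u _ => ?_
  unfold next
  cases s u with
  | none => simp [beepProb]
  | some j =>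
    by_cases h : Hears G b u
    · simp only [h, if_true, beepProb]
      exact le_of_eq (by ring)
    · simp only [h, if_false]
      by_cases hb : b u = true
      · simp only [hb, if_true, beepProb]
        positivity
      · simp only [hb, Bool.false_eq_true, if_false, beepProb]
        cases j with
        | zero => norm_num
        | succ j => exact le_of_eq (by simp only [Nat.add_sub_cancel]; ring)

theorem massBound_le : massBound G s v b ≤ 2 * mass G s v := by
  classical
  unfold massBound mass
  rw [Finset.mul_sum]
  refine Finset.sum_le_sum fun u _ => ?_
  have := beepProb_nonneg (s u)
  split_ifs <;> linarith

theorem le_massBound : mass G s v / 2 ≤ massBound G s v b := by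
  classical
  unfold massBound mass
  rw [Finset.sum_div]
  refine Finset.sum_le_sum fun u _ => ?_
  have := beepProb_nonneg (s u)
  split_ifs <;> linarith

open Classical in
theorem activeNeighbours_next_add_le :
    (activeNeighbours G (next G s b) v : ℝ) + (if NeighbourHalts G s v b then 1 else 0) ≤
      activeNeighbours G s v := by
  have hsub : (Finset.univ.filter fun u => G.Adj v u ∧ next G s b u ≠ none) ⊆
      Finset.univ.filter fun u => G.Adj v u ∧ s u ≠ none := by
    intro u hu
    simp only [Finset.mem_filter, Finset.mem_univ, true_and] at hu ⊢
    refine ⟨hu.1, fun h => hu.2 ?_⟩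
    simp [next, h]
  split_ifs with h
  · obtain ⟨u, hu, hs, hb, hh⟩ := h
    have : activeNeighbours G (next G s b) v < activeNeighbours G s v := by
      refine Finset.card_lt_card ((Finset.ssubset_iff_of_subset hsub).2 ⟨u, ?_, ?_⟩)
      · simp [hu, hs]
      · obtain ⟨j, hj⟩ := Option.ne_none_iff_exists'.1 hs
        have : next G s b u = none := by simp only [next, hj, hh, hb, if_false, if_true]
        simp [this]
    exact_mod_cast this
  · rw [add_zero, Nat.cast_le]
    exact Finset.card_le_card hsub

/-- The beeps `b` are distributed as if the node `u` beeped with probability `beepProb (s u)`,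
independently of the other nodes. -/
structure IsBeepLaw (G : SimpleGraph V) (s : V → Option ℕ) (P : Measure (V → Bool)) : Prop where
  isProbabilityMeasure : IsProbabilityMeasure P
  beep : ∀ u, P.real {b | b u = true} = beepProb (s u)
  beep_beep : ∀ u w, u ≠ w → P.real {b | b u = true ∧ b w = true} = beepProb (s u) * beepProb (s w)
  beep_not_hears : ∀ u, P.real {b | b u = true ∧ ¬ Hears G b u} =
    beepProb (s u) * P.real {b | ¬ Hears G b u}

variable {P : Measure (V → Bool)}

theorem integral_ite (P : Measure (V → Bool)) (p : (V → Bool) → Prop) [DecidablePred p] :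
    ∫ b, (if p b then 1 else 0 : ℝ) ∂P = P.real {b | p b} := by
  have := integral_indicator_one (μ := P) (s := {b | p b}) (Set.toFinite _).measurableSet
  rw [← this]
  refine integral_congr_ae (Eventually.of_forall fun b => ?_)
  simp [Set.indicator_apply]

namespace IsBeepLaw

variable (hP : IsBeepLaw G s P)
include hP

theorem integrable (f : (V → Bool) → ℝ) : Integrable f P := by
  have := hP.isProbabilityMeasure
  exact Integrable.of_finite

theorem hears_le (v : V) : P.real {b | Hears G b v} ≤ mass G s v := by
  classical
  have := hP.isProbabilityMeasure
  have hset : {b : V → Bool | Hears G b v} =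
      ⋃ u ∈ Finset.univ.filter (G.Adj v ·), {b | b u = true} := by
    ext b
    simp [Hears]
  rw [hset]
  refine (measureReal_biUnion_finset_le _ _).trans (le_of_eq ?_)
  exact Finset.sum_congr rfl fun u _ => hP.beep u

theorem not_hears (v : V) : P.real {b | ¬ Hears G b v} = 1 - P.real {b | Hears G b v} := by
  have := hP.isProbabilityMeasure
  exact probReal_compl_eq_one_sub (Set.toFinite _).measurableSet

open Classical in
/-- The expected number of neighbours of `v` that beep alone. -/
noncomputable def _root_.Beeping.adaptiveColouring.successes (G : SimpleGraph V)
    (s : V → Option ℕ) (P : Measure (V → Bool)) (v : V) : ℝ :=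
  ∑ u with G.Adj v u, beepProb (s u) * P.real {b | ¬ Hears G b u}

omit hP in
theorem _root_.Beeping.adaptiveColouring.successes_nonneg : 0 ≤ successes G s P v :=
  Finset.sum_nonneg fun _ _ => mul_nonneg (beepProb_nonneg _) measureReal_nonneg

/-- The factor of a neighbour is `1 / 2`, plus `3 / 2` if it hears nothing: the mass roughly halves
unless many neighbours are expected to beep alone. -/
theorem integral_massBound :
    ∫ b, massBound G s v b ∂P = mass G s v / 2 + 3 / 2 * successes G s P v := by
  classical
  have := hP.isProbabilityMeasure
  unfold massBound mass successes
  rw [integral_finsetSum _ fun u _ => hP.integrable _, Finset.sum_div, Finset.mul_sum,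
    ← Finset.sum_add_distrib]
  refine Finset.sum_congr rfl fun u _ => ?_
  rw [integral_const_mul]
  have : ∀ b : V → Bool, (if Hears G b u then 1 / 2 else 2 : ℝ) =
      1 / 2 + 3 / 2 * (if ¬ Hears G b u then 1 else 0) := by
    intro b
    by_cases h : Hears G b u <;> simp [h]
    norm_num
  simp only [this]
  rw [integral_add (hP.integrable _) (hP.integrable _), integral_const_mul,
    integral_ite P fun b => ¬ Hears G b u]
  simp
  ring

/-- Let `q` be the probability that `v` hears a beep. At level 0, independence of the own beep gives
`q - (1 - q) / 2`, which is the bound; at positive levels the mean `2 * q - 1` is no larger, as `q ≤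
1`. -/
theorem integral_levelChange_le {j : ℕ} (hj : s v = some j) :
    ∫ b, levelChange G j v b ∂P ≤ 3 / 2 * P.real {b | Hears G b v} - 1 / 2 := by
  classical
  have := hP.isProbabilityMeasure
  have hn := hP.not_hears v
  have hle : P.real {b | Hears G b v} ≤ 1 := measureReal_le_one
  rcases Nat.eq_zero_or_pos j with rfl | hpos
  · have : ∀ b : V → Bool, levelChange G 0 v b = (if Hears G b v then 1 else 0) -
        (if b v = true ∧ ¬ Hears G b v then 1 else 0) := by
      intro b
      unfold levelChange
      by_cases h : Hears G b v <;> by_cases hb : b v = true <;> simp [h, hb]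
    simp only [this]
    rw [integral_sub (hP.integrable _) (hP.integrable _), integral_ite P fun b => Hears G b v,
      integral_ite P fun b => b v = true ∧ ¬ Hears G b v, hP.beep_not_hears, hj, hn, beepProb]
    linarith
  · have : ∀ b : V → Bool, levelChange G j v b = 2 * (if Hears G b v then 1 else 0) - 1 := by
      intro b
      unfold levelChange
      by_cases h : Hears G b v <;> simp [h, hpos.ne']
      norm_num
    simp only [this]
    rw [integral_sub (hP.integrable _) (hP.integrable _), integral_const_mul,
      integral_ite P fun b => Hears G b v]
    simp
    linarith

/-- The second moment method: if neighbours of `v` are likely to beep alone in expectation, then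
one of them terminates with a good probability. -/
theorem le_neighbourHalts (hm : 0 < mass G s v) :
    successes G s P v ^ 2 / (mass G s v + mass G s v ^ 2) ≤
      P.real {b | NeighbourHalts G s v b} := by
  classical
  have := hP.isProbabilityMeasure
  set d := mass G s v with hd
  set T := successes G s P v with hT
  set N := Finset.univ.filter (G.Adj v ·) with hN
  let X (b : V → Bool) : ℝ :=
    ∑ u ∈ N, if b u = true ∧ ¬ Hears G b u then 1 else 0
  let S (b : V → Bool) : ℝ := ∑ u ∈ N, if b u = true then 1 else 0
  have hXS : ∀ b, X b ≤ S b := by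
    intro b
    refine Finset.sum_le_sum fun u _ => ?_
    by_cases h : b u = true <;> by_cases h' : Hears G b u <;> simp [h, h']
  have hEX : ∫ b, X b ∂P = T := by
    rw [integral_finsetSum _ fun u _ => hP.integrable _]
    refine Finset.sum_congr rfl fun u _ => ?_
    rw [integral_ite P fun b => b u = true ∧ ¬ Hears G b u, hP.beep_not_hears]
  have hES : ∫ b, S b ^ 2 ∂P ≤ d + d ^ 2 := by
    have hsq : ∀ b, S b ^ 2 = ∑ u ∈ N, ∑ w ∈ N, if b u = true ∧ b w = true then 1 else 0 := by
      intro b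
      rw [sq, Finset.sum_mul_sum]
      refine Finset.sum_congr rfl fun u _ => Finset.sum_congr rfl fun w _ => ?_
      by_cases h : b u = true <;> by_cases h' : b w = true <;> simp [h, h']
    simp only [hsq]
    rw [integral_finsetSum _ fun u _ => hP.integrable _]
    have : ∀ u ∈ N, ∫ b, (∑ w ∈ N, if b u = true ∧ b w = true then 1 else 0 : ℝ) ∂P ≤
        beepProb (s u) + beepProb (s u) * d := by
      intro u hu
      rw [integral_finsetSum _ fun u _ => hP.integrable _, ← Finset.add_sum_erase _ _ hu]
      refine add_le_add ?_ ?_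
      · rw [integral_ite P fun b => b u = true ∧ b u = true]
        simp only [and_self]
        exact (hP.beep u).le
      · rw [hd, mass, Finset.mul_sum]
        refine le_trans (Finset.sum_le_sum fun w hw => ?_)
          (Finset.sum_le_sum_of_subset_of_nonneg (Finset.erase_subset u N) fun w _ _ =>
            mul_nonneg (beepProb_nonneg _) (beepProb_nonneg _))
        rw [integral_ite P fun b => b u = true ∧ b w = true,
          hP.beep_beep u w (Finset.ne_of_mem_erase hw).symm]
    refine (Finset.sum_le_sum this).trans (le_of_eq ?_)
    rw [Finset.sum_add_distrib, ← Finset.sum_mul, sq]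
    rfl
  have hdd : 0 < d + d ^ 2 := by positivity
  -- This `α` maximises `2 * α * T - α ^ 2 * (d + d ^ 2)`, a lower bound for the mean of the left
  -- side of `hpt`.
  set α := T / (d + d ^ 2) with hα
  have hα0 : 0 ≤ α := div_nonneg successes_nonneg hdd.le
  have hαd : α * (d + d ^ 2) = T := div_mul_cancel₀ _ hdd.ne'
  have hae : ∀ᵐ b ∂P, ∀ u, b u = true → s u ≠ none := by
    rw [ae_all_iff]
    intro u
    by_cases hu : s u = none
    · have h0 := hP.beep u
      rw [hu, beepProb, measureReal_eq_zero_iff] at h0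
      refine measure_mono_null (fun b hb => ?_) h0
      simp only [Set.mem_compl_iff, Set.mem_ofPred_eq, Classical.not_imp] at hb
      exact hb.1
    · exact Eventually.of_forall fun b _ => hu
  have hpt : ∀ᵐ b ∂P, 2 * α * X b - α ^ 2 * S b ^ 2 ≤
      if NeighbourHalts G s v b then 1 else 0 := by
    filter_upwards [hae] with b hb
    split_ifs with h
    · have := mul_le_mul_of_nonneg_left (hXS b) hα0
      nlinarith [sq_nonneg (1 - α * S b)]
    · have hX : X b = 0 := by
        refine Finset.sum_eq_zero fun u hu => if_neg fun hu' => h ⟨u, ?_, hb u hu'.1, hu'⟩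
        simpa [hN] using hu
      rw [hX]
      nlinarith [sq_nonneg (α * S b)]
  have hint := integral_mono_ae (hP.integrable _) (hP.integrable _) hpt
  rw [integral_ite P fun b => NeighbourHalts G s v b,
    integral_sub (hP.integrable _) (hP.integrable _), integral_const_mul, integral_const_mul,
    hEX] at hint
  refine le_trans ?_ hint
  have h1 : T ^ 2 / (d + d ^ 2) = α * T := by rw [hα]; ring
  rw [h1]
  have h2 := mul_le_mul_of_nonneg_left hES (sq_nonneg α)
  have h3 : α ^ 2 * (d + d ^ 2) = α * T := by rw [← hαd]; ring
  linarith

end IsBeepLaw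

/-- The exponent of the potential of `v`, without the scaling factor. -/
noncomputable def exponent (G : SimpleGraph V) (s : V → Option ℕ) (v : V) (j : ℕ) : ℝ :=
  -- The floor `1 / 8` bounds the logarithm from below. The weight is `2 * 17408`, where `1 / 17408`
  -- bounds the probability of a neighbour terminating in the last case of `exists_drift`.
  j / 2 + Real.log (max (mass G s v) (1 / 8)) + 34816 * activeNeighbours G s v

/-- The exponent of the potential has a negative drift. -/
theorem exists_drift (hP : IsBeepLaw G s P) {j : ℕ} (hj : s v = some j) :
    ∃ X : (V → Bool) → ℝ, (∀ b, |X b| ≤ 40000) ∧ ∫ b, X b ∂P ≤ -(1 / 32) ∧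
      ∀ b j', next G s b v = some j' →
        exponent G (next G s b) v j' ≤ exponent G s v j + X b := by
  classical
  have := hP.isProbabilityMeasure
  set d := mass G s v with hd
  set T := successes G s P v with hT
  have hd0 : 0 ≤ d := mass_nonneg G s v
  have hY := hP.integral_levelChange_le hj
  have hq := hP.hears_le v
  have hq1 : P.real {b | Hears G b v} ≤ 1 := measureReal_le_one
  have hYabs := fun b => abs_le.1 (abs_levelChange_le (G := G) j v b)
  have hlog2 : 0.693 < Real.log 2 := lt_trans (by norm_num) Real.log_two_gt_d9
  have hlog2' : Real.log 2 < 0.694 := lt_trans Real.log_two_lt_d9 (by norm_num)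
  have hmain : ∀ L : (V → Bool) → ℝ, (∀ b, Real.log (max (mass G (next G s b) v) (1 / 8)) ≤
      Real.log (max d (1 / 8)) + L b) → ∀ b j', next G s b v = some j' →
        exponent G (next G s b) v j' + 34816 * (if NeighbourHalts G s v b then 1 else 0) ≤
          exponent G s v j + (levelChange G j v b / 2 + L b) := by
    intro L hL b j' hj'
    have h1 := hL b
    have h2 := level_le hj hj'
    have h3 := activeNeighbours_next_add_le (G := G) (s := s) (v := v) (b := b)
    unfold exponent
    linarith
  have hmain' : ∀ L : (V → Bool) → ℝ, (∀ b, Real.log (max (mass G (next G s b) v) (1 / 8)) ≤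
      Real.log (max d (1 / 8)) + L b) → ∀ b j', next G s b v = some j' →
        exponent G (next G s b) v j' ≤
          exponent G s v j + (levelChange G j v b / 2 + L b) := by
    intro L hL b j' hj'
    refine le_trans ?_ (hmain L hL b j' hj')
    split_ifs <;> simp
  -- Tiny mass: even doubled it stays under the floor `1 / 8`, and `v` hears a beep with probability
  -- at most `1 / 16`, so the level alone provides the drift.
  rcases le_or_gt d (1 / 16) with h16 | h16
  · refine ⟨fun b => levelChange G j v b / 2 + 0, fun b => ?_, ?_, hmain' (fun _ => 0) fun b => ?_⟩
    · rw [abs_le]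
      constructor <;> linarith [hYabs b]
    · simp only [add_zero]
      rw [integral_div]
      linarith
    · rw [add_zero, max_eq_right (by linarith : d ≤ 1 / 8), max_eq_right]
      linarith [mass_next_le (G := G) (s := s) (b := b) (v := v),
        massBound_le (G := G) (s := s) (b := b) (v := v)]
  have hdpos : 0 < d := by linarith
  let r (b : V → Bool) : ℝ := massBound G s v b / d
  have hr : ∀ b, 1 / 2 ≤ r b ∧ r b ≤ 2 := by
    intro b
    have h1 := massBound_le (G := G) (s := s) (b := b) (v := v)
    have h2 := le_massBound (G := G) (s := s) (b := b) (v := v)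
    constructor
    · rw [le_div_iff₀ hdpos]; linarith
    · rw [div_le_iff₀ hdpos]; linarith
  have hrd : ∀ b, mass G (next G s b) v ≤ r b * d := by
    intro b
    rw [div_mul_cancel₀ _ hdpos.ne']
    exact mass_next_le
  have hEr : ∫ b, r b ∂P = 1 / 2 + 3 / 2 * (T / d) := by
    rw [integral_div, hP.integral_massBound]
    field_simp
    rfl
  rcases le_or_gt T (d / 32) with hT32 | hT32
  -- Few successes: `r` has mean at most `35 / 64`.
  · have hTd : T / d ≤ 1 / 32 := by
      rw [div_le_iff₀ hdpos]; linarith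
    rcases le_or_gt d (1 / 4) with h4 | h4
    -- On `[1 / 2, 2]` the chord `2 / 3 * (r - 1 / 2)` dominates `log (max r 1)`. Its mean is at
    -- most `1 / 32` and the level contributes at most `-1 / 16`; this case determines the drift `-1
    -- / 32`.
    · refine ⟨fun b => levelChange G j v b / 2 + 2 / 3 * (r b - 1 / 2), fun b => ?_, ?_,
        hmain' (fun b => 2 / 3 * (r b - 1 / 2)) fun b => ?_⟩
      · rw [abs_le]
        constructor <;> linarith [hYabs b, hr b]
      · rw [integral_add (hP.integrable _) (hP.integrable _), integral_div, integral_const_mul,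
          integral_sub (hP.integrable _) (hP.integrable _), hEr]
        simp only [integral_const, probReal_univ, smul_eq_mul]
        linarith
      · have hD : (0 : ℝ) < max d (1 / 8) := lt_max_of_lt_left hdpos
        have hle : max (mass G (next G s b) v) (1 / 8) ≤ max (r b) 1 * max d (1 / 8) := by
          refine max_le ((hrd b).trans ?_) ?_
          · exact mul_le_mul (le_max_left _ _) (le_max_left _ _) hd0
              (zero_le_one.trans (le_max_right _ _))
          · calc (1 / 8 : ℝ) = 1 * (1 / 8) := by ring
              _ ≤ _ := mul_le_mul (le_max_right _ _) (le_max_right _ _) (by norm_num)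
                (zero_le_one.trans (le_max_right _ _))
        have h1 : (0 : ℝ) < max (r b) 1 := lt_max_of_lt_right one_pos
        refine (Real.log_le_log (lt_max_of_lt_right (by norm_num)) hle).trans ?_
        rw [Real.log_mul h1.ne' hD.ne', add_comm]
        have h2 := Real.log_le_sub_one_of_pos h1
        have h3 : max (r b) 1 - 1 ≤ 2 / 3 * (r b - 1 / 2) := by
          rcases max_cases (r b) 1 with ⟨h, -⟩ | ⟨h, -⟩ <;> rw [h] <;> linarith [hr b]
        linarith
    -- Now `r * d ≥ 1 / 8`, so the floor is inactive. The tangent of `log` at `1 / 2` shows that the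
    -- loss of logarithmic mass outweighs the level's gain of at most `1 / 2`.
    · refine ⟨fun b => levelChange G j v b / 2 + (2 * r b - 1 - Real.log 2), fun b => ?_, ?_,
        hmain' (fun b => 2 * r b - 1 - Real.log 2) fun b => ?_⟩
      · rw [abs_le]
        constructor <;> linarith [hYabs b, hr b]
      · rw [integral_add (hP.integrable _) (hP.integrable _), integral_div,
          integral_sub (hP.integrable _) (hP.integrable _),
          integral_sub (hP.integrable _) (hP.integrable _), integral_const_mul, hEr]
        simp only [integral_const, probReal_univ, smul_eq_mul]
        linarith
      · have hrpos : 0 < r b := by linarith [(hr b).1]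
        have hle : max (mass G (next G s b) v) (1 / 8) ≤ r b * d := by
          refine max_le (hrd b) ?_
          nlinarith [(hr b).1]
        refine (Real.log_le_log (lt_max_of_lt_right (by norm_num)) hle).trans ?_
        rw [Real.log_mul hrpos.ne' hdpos.ne', max_eq_left (by linarith : 1 / 8 ≤ d)]
        have h2 := Real.log_le_sub_one_of_pos (show 0 < 2 * r b by linarith)
        rw [Real.log_mul (by norm_num) hrpos.ne'] at h2
        linarith
  -- Many successes: with `T > d / 32` and `d > 1 / 16` a neighbour terminates with probability at
  -- least `1 / 17408`. The mean loss of at least 2 beats the worst-case gain `1 / 2 + log 2`.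
  · refine ⟨fun b => 1 / 2 + Real.log 2 - 34816 * (if NeighbourHalts G s v b then 1 else 0),
      fun b => ?_, ?_, fun b j' hj' => ?_⟩
    · rw [abs_le]
      by_cases h : NeighbourHalts G s v b <;> simp only [h, if_true, if_false] <;>
        constructor <;> linarith
    · rw [integral_sub (hP.integrable _) (hP.integrable _), integral_const_mul,
        integral_ite P fun b => NeighbourHalts G s v b]
      simp only [integral_const, probReal_univ, smul_eq_mul]
      have h1 := hP.le_neighbourHalts (v := v) hdpos
      have h2 : (1 / 17408 : ℝ) ≤ T ^ 2 / (d + d ^ 2) := by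
        rw [le_div_iff₀ (by positivity)]
        nlinarith
      linarith
    · have := hmain (fun _ => Real.log 2) (fun b => ?_) b j' hj'
      · linarith [hYabs b]
      · have hD : (0 : ℝ) < max d (1 / 8) := lt_max_of_lt_left hdpos
        have hle : max (mass G (next G s b) v) (1 / 8) ≤ 2 * max d (1 / 8) := by
          refine max_le ?_ ?_
          · have h1 := (mass_next_le (G := G) (s := s) (b := b) (v := v)).trans massBound_le
            linarith [le_max_left d (1 / 8)]
          · linarith [le_max_right d (1 / 8)]
        refine (Real.log_le_log (lt_max_of_lt_right (by norm_num)) hle).trans ?_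
        rw [Real.log_mul (by norm_num) hD.ne', add_comm]

/-- The scaling factor of the exponent of the potential. -/
noncomputable def rate : ℝ := 1 / 102400000000

/-- The potential of a node. -/
noncomputable def potential (G : SimpleGraph V) (v : V) (s : V → Option ℕ) : ℝ :=
  match s v with
  | none => 0
  | some j => Real.exp (rate * exponent G s v j)

theorem potential_nonneg (G : SimpleGraph V) (v : V) (s : V → Option ℕ) :
    0 ≤ potential G v s := by
  unfold potential
  cases s v with
  | none => exact le_rfl
  | some j => exact (Real.exp_pos _).le

/-- Expand the exponential to second order: the linear term contributes at most `-rate / 32` and the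
quadratic remainder at most `rate / 64`. Termination sends the potential to zero and only helps. -/
theorem integral_potential_next_le (hP : IsBeepLaw G s P) (v : V) :
    ∫ b, potential G v (next G s b) ∂P ≤ (1 - rate / 64) * potential G v s := by
  have := hP.isProbabilityMeasure
  cases hj : s v with
  | none =>
    have h1 : ∀ b, potential G v (next G s b) = 0 := by
      intro b
      have : next G s b v = none := by simp [next, hj]
      simp [potential, this]
    have h2 : potential G v s = 0 := by simp [potential, hj]
    simp [h1, h2]
  | some j =>
    obtain ⟨X, hXabs, hEX, hX⟩ := exists_drift hP hj
    have h2 : potential G v s = Real.exp (rate * exponent G s v j) := by simp [potential, hj]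
    have hrate : rate = 1 / 102400000000 := rfl
    have hrate0 : 0 < rate := by rw [hrate]; norm_num
    have hpt : ∀ b, potential G v (next G s b) ≤
        Real.exp (rate * exponent G s v j) * (1 + rate * X b + rate ^ 2 * 40000 ^ 2) := by
      intro b
      have hsmall : |rate * X b| ≤ rate * 40000 := by
        rw [abs_mul, abs_of_pos hrate0]
        exact mul_le_mul_of_nonneg_left (hXabs b) hrate0.le
      have h3 := Real.abs_exp_sub_one_sub_id_le
        (hsmall.trans (by rw [hrate]; norm_num : rate * 40000 ≤ 1))
      have h4 : (rate * X b) ^ 2 ≤ rate ^ 2 * 40000 ^ 2 := by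
        rw [← mul_pow, ← sq_abs]
        exact pow_le_pow_left₀ (abs_nonneg _) hsmall 2
      have h5 : Real.exp (rate * X b) ≤ 1 + rate * X b + rate ^ 2 * 40000 ^ 2 := by
        linarith [(abs_le.1 h3).2]
      refine le_trans ?_ (mul_le_mul_of_nonneg_left h5 (Real.exp_pos _).le)
      rw [← Real.exp_add]
      cases hj' : next G s b v with
      | none =>
        simp only [potential, hj']
        exact (Real.exp_pos _).le
      | some j' =>
        simp only [potential, hj']
        refine Real.exp_le_exp.2 ?_
        rw [← mul_add]
        exact mul_le_mul_of_nonneg_left (hX b j' hj') hrate0.le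
    refine (integral_mono (hP.integrable _) (hP.integrable _) hpt).trans ?_
    rw [integral_const_mul, integral_add (hP.integrable _) (hP.integrable _),
      integral_add (hP.integrable _) (hP.integrable _), integral_const_mul, h2, mul_comm]
    simp only [integral_const, probReal_univ, smul_eq_mul]
    refine mul_le_mul_of_nonneg_right ?_ (Real.exp_pos _).le
    have h6 := mul_le_mul_of_nonneg_left hEX hrate0.le
    -- The rate is `1 / (64 * 40000 ^ 2)`, so that the remainder uses up half of the drift.
    have h7 : rate ^ 2 * 40000 ^ 2 = rate / 64 := by rw [hrate]; norm_num
    linarith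

end adaptiveColouring
end Beeping

namespace Beeping
namespace adaptiveColouring

/-! ### The running time of the adaptive colouring algorithm -/

variable {V : Type}

theorem measurable_beeping (s : V → Option ℕ) : Measurable (beeping s) := by
  refine measurable_pi_iff.2 fun v => ?_
  refine measurable_to_bool ?_
  have : (fun ξ : V → unitInterval => beeping s ξ v) ⁻¹' {true} =
      {ξ | (ξ v : ℝ) < beepProb (s v)} := by
    ext ξ
    simp [beeping]
  rw [this]
  exact measurableSet_lt (measurable_subtype_coe.comp (measurable_pi_apply _)) measurable_const

theorem state_congr (G : SimpleGraph V) {t : ℕ} {ω ω' : V → ℕ → unitInterval}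
    (h : ∀ v, ∀ i < t, ω v i = ω' v i) : state G t ω = state G t ω' := by
  have := Algorithm.history_congr (A := adaptiveColouring) (G := G) (t := t) (ω := ω) (ω' := ω')
    fun v l hl => by simp only [adaptiveColouring, h v l.length hl]
  funext v
  unfold state
  rw [this]

variable [Fintype V]

/-- Random numbers for all nodes in one slot. -/
noncomputable def slotLaw (V : Type) [Fintype V] : Measure (V → unitInterval) :=
  Measure.pi fun _ => volume

instance : IsProbabilityMeasure (slotLaw V) := by unfold slotLaw; infer_instance

theorem isBeepLaw (G : SimpleGraph V) (s : V → Option ℕ) :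
    IsBeepLaw G s ((slotLaw V).map (beeping s)) := by
  classical
  have hm := measurable_beeping s
  have hreal : ∀ p : (V → Bool) → Prop, ((slotLaw V).map (beeping s)).real {b | p b} =
      (slotLaw V).real {ξ | p (beeping s ξ)} := fun p =>
    map_measureReal_apply hm (Set.toFinite _).measurableSet
  have hmeas : ∀ p : (V → Bool) → Prop, MeasurableSet {ξ | p (beeping s ξ)} := fun p =>
    hm (Set.toFinite {b | p b}).measurableSet
  have hone : ∀ u, (slotLaw V).real {ξ | beeping s ξ u = true} = beepProb (s u) := by
    intro u
    have h1 : beepProb (s u) ≤ 1 := (beepProb_le_half _).trans (by norm_num)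
    let x : unitInterval := ⟨beepProb (s u), beepProb_nonneg _, h1⟩
    have hset : {ξ | beeping s ξ u = true} = Function.eval u ⁻¹' Set.Iio x := by
      ext ξ
      simp only [beeping, decide_eq_true_iff, Set.mem_preimage, Set.mem_Iio, Function.eval,
        Set.mem_ofPred_eq, ← Subtype.coe_lt_coe, x]
    rw [hset, measureReal_def, slotLaw,
      (measurePreserving_eval (fun _ : V => (volume : Measure unitInterval)) u).measure_preimage
        measurableSet_Iio.nullMeasurableSet, unitInterval.volume_Iio,
      ENNReal.toReal_ofReal (beepProb_nonneg _)]
  have hcongr : ∀ (ξ ξ' : V → unitInterval) u, ξ u = ξ' u → beeping s ξ u = beeping s ξ' u := by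
    intro ξ ξ' u h
    simp [beeping, h]
  refine ⟨Measure.isProbabilityMeasure_map hm.aemeasurable, fun u => ?_, fun u w huw => ?_,
    fun u => ?_⟩
  · rw [hreal fun b => b u = true, hone]
  · rw [hreal fun b => b u = true ∧ b w = true]
    have := measure_inter_of_disjoint (volume : Measure unitInterval) (S := {u}) (T := {w})
      (by simpa using huw) (hmeas fun b => b u = true) (hmeas fun b => b w = true)
      (fun x y h hx => (hcongr x y u (h u (by simp))).symm.trans hx)
      (fun x y h hx => (hcongr x y w (h w (by simp))).symm.trans hx)
    rw [← hone, ← hone, measureReal_def, measureReal_def, measureReal_def, ← ENNReal.toReal_mul]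
    exact congrArg ENNReal.toReal this
  · rw [hreal fun b => b u = true ∧ ¬ Hears G b u, hreal fun b => ¬ Hears G b u]
    have := measure_inter_of_disjoint (volume : Measure unitInterval) (S := {u})
      (T := Finset.univ.filter (G.Adj u ·)) (by simp)
      (hmeas fun b => b u = true) (hmeas fun b => ¬ Hears G b u)
      (fun x y h hx => (hcongr x y u (h u (by simp))).symm.trans hx)
      (by
        rintro x y h hx ⟨w, hw, hb⟩
        exact hx ⟨w, hw, (hcongr x y w (h w (by simpa using hw))).trans hb⟩)
    rw [← hone, measureReal_def, measureReal_def, measureReal_def, ← ENNReal.toReal_mul]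
    exact congrArg ENNReal.toReal this

instance : MeasurableSpace (Option ℕ) := ⊤
instance : DiscreteMeasurableSpace (Option ℕ) := ⟨fun _ => trivial⟩

/-- The law of the random numbers of all nodes in all slots. -/
noncomputable def seedLaw (V : Type) [Fintype V] : Measure (V → ℕ → unitInterval) :=
  Measure.pi fun _ => Measure.infinitePi fun _ => volume

instance : IsProbabilityMeasure (seedLaw V) := by unfold seedLaw; infer_instance

theorem measurable_state (G : SimpleGraph V) (t : ℕ) :
    Measurable (state G t) := by
  have : Measurable fun (h : V → List Percept) v => status (h v) := Measurable.of_discrete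
  exact this.comp (Algorithm.measurable_history adaptiveColouring G t)

/-- The state after `t` slots is independent of the random numbers used in the next slot. -/
theorem indepFun_state (G : SimpleGraph V) (t : ℕ) :
    ProbabilityTheory.IndepFun (state G t)
      (fun (ω : V → ℕ → unitInterval) v => ω v t) (seedLaw V) := by
  classical
  have hind : ProbabilityTheory.iIndepFun
      (fun (p : V × ℕ) (ω : V → ℕ → unitInterval) => ω p.1 p.2) (seedLaw V) := by
    have := ProbabilityTheory.iIndepFun_uncurry_infinitePi'
      (μ := fun (_ : V) (_ : ℕ) => (volume : Measure unitInterval))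
      (X := fun _ _ => (id : unitInterval → unitInterval)) (fun _ _ => measurable_id)
    rw [Measure.infinitePi_eq_pi] at this
    exact this
  have h2 := hind.indepFun_finset (Finset.univ ×ˢ Finset.range t) (Finset.univ ×ˢ {t})
    (by
      rw [Finset.disjoint_left]
      rintro ⟨v, i⟩ h h'
      simp at h h'
      omega)
    (fun p => (measurable_pi_apply p.2).comp (measurable_pi_apply p.1))
  -- The state factors through the numbers of the slots before `t`; all other numbers are set to 0.
  let past (η : (Finset.univ ×ˢ Finset.range t : Finset (V × ℕ)) → unitInterval) (v : V) (i : ℕ) :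
      unitInterval := if h : (v, i) ∈ (Finset.univ ×ˢ Finset.range t : Finset (V × ℕ)) then
        η ⟨(v, i), h⟩ else 0
  have hpast : Measurable past := by
    refine measurable_pi_iff.2 fun v => measurable_pi_iff.2 fun i => ?_
    by_cases h : (v, i) ∈ (Finset.univ ×ˢ Finset.range t : Finset (V × ℕ))
    · simpa only [past, h, dif_pos] using measurable_pi_apply _
    · simpa only [past, h, dif_neg, not_false_eq_true] using measurable_const
  let now (η : (Finset.univ ×ˢ {t} : Finset (V × ℕ)) → unitInterval) (v : V) : unitInterval :=
    η ⟨(v, t), by simp⟩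
  have hnow : Measurable now := measurable_pi_iff.2 fun v => measurable_pi_apply _
  have h3 := h2.comp ((measurable_state G t).comp hpast) hnow
  have hstate : state G t = (state G t ∘ past) ∘
      fun (ω : V → ℕ → unitInterval) (p : (Finset.univ ×ˢ Finset.range t : Finset (V × ℕ))) =>
        ω p.1.1 p.1.2 := by
    funext ω
    refine state_congr G fun v i hi => ?_
    simp [past, hi]
  rw [hstate]
  exact h3

theorem map_slot (t : ℕ) :
    (seedLaw V).map (fun ω v => ω v t) = slotLaw V := by
  have h := measurePreserving_eval_infinitePi (fun _ : ℕ => (volume : Measure unitInterval)) t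
  exact (measurePreserving_pi (fun _ : V => Measure.infinitePi fun _ : ℕ => volume)
    (fun _ : V => (volume : Measure unitInterval)) fun _ => h).map_eq

/-- By independence of the state and the fresh numbers, Fubini reduces this to the drift bound for
each fixed state. -/
theorem lintegral_potential_succ_le (G : SimpleGraph V) (v : V) (t : ℕ) :
    ∫⁻ ω, ENNReal.ofReal (potential G v (state G (t + 1) ω)) ∂seedLaw V ≤
      ENNReal.ofReal (1 - rate / 64) *
        ∫⁻ ω, ENNReal.ofReal (potential G v (state G t ω)) ∂seedLaw V := by
  have hslot : Measurable fun (ω : V → ℕ → unitInterval) v => ω v t :=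
    measurable_pi_iff.2 fun v => (measurable_pi_apply t).comp (measurable_pi_apply v)
  have hstate := measurable_state G t
  let F (p : (V → Option ℕ) × (V → unitInterval)) : ENNReal :=
    ENNReal.ofReal (potential G v (next G p.1 (beeping p.1 p.2)))
  have hF : Measurable F := by
    refine measurable_from_prod_countable_right fun s => ?_
    have : Measurable fun b : V → Bool => ENNReal.ofReal (potential G v (next G s b)) :=
      Measurable.of_discrete
    exact this.comp (measurable_beeping s)
  have hstep : ∀ s, ∫⁻ ξ, F (s, ξ) ∂slotLaw V ≤
      ENNReal.ofReal (1 - rate / 64) * ENNReal.ofReal (potential G v s) := by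
    intro s
    have hP := isBeepLaw G s
    have hint := integral_potential_next_le hP v
    have hf : Measurable fun b : V → Bool => ENNReal.ofReal (potential G v (next G s b)) :=
      Measurable.of_discrete
    have h1 : ∫⁻ ξ, F (s, ξ) ∂slotLaw V = ∫⁻ b, ENNReal.ofReal (potential G v (next G s b))
        ∂(slotLaw V).map (beeping s) := (lintegral_map hf (measurable_beeping s)).symm
    rw [h1, ← ofReal_integral_eq_lintegral_ofReal (hP.integrable _)
      (Eventually.of_forall fun b => potential_nonneg G v _), ← ENNReal.ofReal_mul
      (by rw [show rate = 1 / 102400000000 from rfl]; norm_num)]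
    exact ENNReal.ofReal_le_ofReal hint
  have hmap : (seedLaw V).map (fun ω => (state G t ω, fun v => ω v t)) =
      ((seedLaw V).map (state G t)).prod (slotLaw V) := by
    rw [← map_slot t]
    exact (ProbabilityTheory.indepFun_iff_map_prod_eq_prod_map_map hstate.aemeasurable
      hslot.aemeasurable).1 (indepFun_state G t)
  calc ∫⁻ ω, ENNReal.ofReal (potential G v (state G (t + 1) ω)) ∂seedLaw V
      = ∫⁻ ω, F (state G t ω, fun v => ω v t) ∂seedLaw V := by simp only [state_succ, F]
    _ = ∫⁻ p, F p ∂((seedLaw V).map (state G t)).prod (slotLaw V) := by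
        rw [← hmap, lintegral_map hF (hstate.prodMk hslot)]
    _ = ∫⁻ s, ∫⁻ ξ, F (s, ξ) ∂slotLaw V ∂(seedLaw V).map (state G t) :=
        lintegral_prod _ hF.aemeasurable
    _ = ∫⁻ ω, ∫⁻ ξ, F (state G t ω, ξ) ∂slotLaw V ∂seedLaw V :=
        lintegral_map hF.lintegral_prod_right' hstate
    _ ≤ ∫⁻ ω, ENNReal.ofReal (1 - rate / 64) * ENNReal.ofReal (potential G v (state G t ω))
          ∂seedLaw V := lintegral_mono fun ω => hstep _
    _ = _ := by
        refine lintegral_const_mul _ ?_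
        have : Measurable fun s : V → Option ℕ => ENNReal.ofReal (potential G v s) :=
          Measurable.of_discrete
        exact this.comp hstate

open Classical in
-- `34817 = 34816 + 1`: active neighbours contribute at most `34816 * Δ`, and the logarithm of the
-- mass at most `Δ`.
theorem potential_initial_le (G : SimpleGraph V) (v : V) (ω : V → ℕ → unitInterval) :
    potential G v (state G 0 ω) ≤ Real.exp (rate * (34817 * G.maxDegree)) := by
  have hs : state G 0 ω = fun _ => some 0 := rfl
  have hdeg : ((Finset.univ.filter fun u => G.Adj v u).card : ℝ) ≤ G.maxDegree := by
    have := G.degree_le_maxDegree v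
    rw [← SimpleGraph.card_neighborFinset_eq_degree, SimpleGraph.neighborFinset_eq_filter] at this
    exact_mod_cast this
  have hact : (activeNeighbours G (state G 0 ω) v : ℝ) ≤ G.maxDegree := by
    refine le_trans ?_ hdeg
    rw [Nat.cast_le]
    refine Finset.card_le_card fun u hu => ?_
    simp only [Finset.mem_filter, Finset.mem_univ, true_and] at hu ⊢
    exact hu.1
  have hmass : mass G (state G 0 ω) v ≤ G.maxDegree := by
    refine le_trans ?_ hdeg
    unfold mass
    rw [Finset.card_eq_sum_ones, Nat.cast_sum]
    refine Finset.sum_le_sum fun u _ => (beepProb_le_half _).trans ?_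
    norm_num
  have hlog : Real.log (max (mass G (state G 0 ω) v) (1 / 8)) ≤ G.maxDegree := by
    have hpos : (0 : ℝ) ≤ G.maxDegree := Nat.cast_nonneg _
    rcases max_cases (mass G (state G 0 ω) v) (1 / 8) with ⟨h, h'⟩ | ⟨h, h'⟩ <;> rw [h]
    · have := Real.log_le_sub_one_of_pos (show 0 < mass G (state G 0 ω) v by linarith)
      linarith
    · exact (Real.log_nonpos (by norm_num) (by norm_num)).trans hpos
  have hrate : 0 ≤ rate := by rw [show rate = 1 / 102400000000 from rfl]; norm_num
  have hp : potential G v (state G 0 ω) =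
      Real.exp (rate * exponent G (state G 0 ω) v 0) := rfl
  rw [hp]
  refine Real.exp_le_exp.2 (mul_le_mul_of_nonneg_left ?_ hrate)
  unfold exponent
  push_cast
  linarith

theorem le_potential (G : SimpleGraph V) {v : V} {s : V → Option ℕ} (h : s v ≠ none) :
    Real.exp (-1) ≤ potential G v s := by
  obtain ⟨j, hj⟩ := Option.ne_none_iff_exists'.1 h
  have hp : potential G v s = Real.exp (rate * exponent G s v j) := by simp [potential, hj]
  rw [hp]
  refine Real.exp_le_exp.2 ?_
  have hlog : -8 ≤ Real.log (max (mass G s v) (1 / 8)) := by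
    refine le_trans ?_ (Real.log_le_log (by norm_num) (le_max_right (mass G s v) (1 / 8)))
    rw [one_div, Real.log_inv]
    linarith [Real.log_le_sub_one_of_pos (show (0 : ℝ) < 8 by norm_num)]
  have : -8 ≤ exponent G s v j := by
    unfold exponent
    have h1 : (0 : ℝ) ≤ j := Nat.cast_nonneg _
    have h2 : (0 : ℝ) ≤ activeNeighbours G s v := Nat.cast_nonneg _
    linarith
  rw [show rate = 1 / 102400000000 from rfl]
  linarith

open Classical in
/-- The probability that a node has not terminated decreases exponentially. -/
theorem measure_active_le (G : SimpleGraph V) (v : V) (t : ℕ) :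
    (seedLaw V).real {ω | state G t ω v ≠ none} ≤
      Real.exp (1 + rate * (34817 * G.maxDegree) - rate / 64 * t) := by
  have hrate : rate = 1 / 102400000000 := rfl
  have hbase : 0 ≤ 1 - rate / 64 := by rw [hrate]; norm_num
  have hlint : ∫⁻ ω, ENNReal.ofReal (potential G v (state G t ω)) ∂seedLaw V ≤
      ENNReal.ofReal ((1 - rate / 64) ^ t * Real.exp (rate * (34817 * G.maxDegree))) := by
    induction t with
    | zero =>
      rw [pow_zero, one_mul]
      refine (lintegral_mono fun ω => ENNReal.ofReal_le_ofReal
        (potential_initial_le G v ω)).trans ?_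
      simp
    | succ t ih =>
      refine (lintegral_potential_succ_le G v t).trans ((mul_le_mul_right ih _).trans ?_)
      rw [← ENNReal.ofReal_mul hbase, ← mul_assoc, pow_succ']
  -- Markov's inequality, since the potential of an active node is at least `exp (-1)`.
  have hmarkov : ENNReal.ofReal (Real.exp (-1)) * seedLaw V {ω | state G t ω v ≠ none} ≤
      ENNReal.ofReal ((1 - rate / 64) ^ t * Real.exp (rate * (34817 * G.maxDegree))) := by
    refine le_trans (le_trans ?_ (mul_meas_ge_le_lintegral₀ ?_ (ENNReal.ofReal (Real.exp (-1)))))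
      hlint
    · refine mul_le_mul_right (measure_mono fun ω hω => ?_) _
      exact ENNReal.ofReal_le_ofReal (le_potential G hω)
    · have : Measurable fun s : V → Option ℕ => ENNReal.ofReal (potential G v s) :=
        Measurable.of_discrete
      exact (this.comp (measurable_state G t)).aemeasurable
  have hreal := ENNReal.toReal_mono ENNReal.ofReal_ne_top hmarkov
  rw [ENNReal.toReal_mul, ENNReal.toReal_ofReal (Real.exp_pos _).le,
    ENNReal.toReal_ofReal (by positivity), ← measureReal_def] at hreal
  have hpow : (1 - rate / 64) ^ t ≤ Real.exp (-(rate / 64 * t)) := by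
    calc (1 - rate / 64) ^ t ≤ Real.exp (-(rate / 64)) ^ t :=
          pow_le_pow_left₀ hbase (Real.one_sub_le_exp_neg _) t
      _ = _ := by rw [← Real.exp_nat_mul]; congr 1; ring
  have h1 : Real.exp (1 + rate * (34817 * G.maxDegree) - rate / 64 * t) =
      Real.exp 1 * (Real.exp (-(rate / 64 * t)) * Real.exp (rate * (34817 * G.maxDegree))) := by
    rw [← Real.exp_add, ← Real.exp_add]
    congr 1
    ring
  have h2 : (seedLaw V).real {ω | state G t ω v ≠ none} = Real.exp 1 *
      (Real.exp (-1) * (seedLaw V).real {ω | state G t ω v ≠ none}) := by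
    rw [← mul_assoc, ← Real.exp_add]
    simp
  rw [h1, h2]
  refine mul_le_mul_of_nonneg_left (hreal.trans ?_) (Real.exp_pos _).le
  exact mul_le_mul_of_nonneg_right hpow (Real.exp_pos _).le

open Classical in
theorem measure_not_terminatedBy_le (G : SimpleGraph V) (t : ℕ) :
    (adaptiveColouring.seeds V).real {ω | ¬ adaptiveColouring.TerminatedBy G ω t} ≤
      Fintype.card V * Real.exp (1 + rate * (34817 * G.maxDegree) - rate / 64 * t) := by
  have hset : {ω : V → ℕ → unitInterval | ¬ adaptiveColouring.TerminatedBy G ω t} =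
      ⋃ v ∈ (Finset.univ : Finset V), {ω | state G t ω v ≠ none} := by
    ext ω
    refine (not_congr (terminatedBy_iff (ω := ω))).trans ?_
    simp [state]
  change (seedLaw V).real {ω : V → ℕ → unitInterval | ¬ adaptiveColouring.TerminatedBy G ω t} ≤ _
  rw [hset]
  refine (measureReal_biUnion_finset_le _ _).trans
    ((Finset.sum_le_sum fun v _ => measure_active_le G v t).trans (le_of_eq ?_))
  rw [Finset.sum_const, Finset.card_univ, nsmul_eq_mul]

theorem isLasVegasColouring : adaptiveColouring.IsLasVegasColouring := by
  classical
  intro V _ G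
  have : IsProbabilityMeasure (adaptiveColouring.seeds V) := by
    unfold Algorithm.seeds; infer_instance
  have hrate : 0 < rate / 64 := by rw [show rate = 1 / 102400000000 from rfl]; norm_num
  have hzero : (adaptiveColouring.seeds V).real
      {ω | ¬ ∃ t, adaptiveColouring.TerminatedBy G ω t} = 0 := by
    refine le_antisymm ?_ measureReal_nonneg
    have hlim : Tendsto (fun t : ℕ => Fintype.card V *
        Real.exp (1 + rate * (34817 * G.maxDegree) - rate / 64 * t)) atTop (nhds 0) := by
      rw [← mul_zero (Fintype.card V : ℝ)]
      refine Tendsto.const_mul _ (Real.tendsto_exp_atBot.comp ?_)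
      exact tendsto_atBot_add_const_left _ _ (tendsto_neg_atTop_atBot.comp
        (tendsto_natCast_atTop_atTop.const_mul_atTop hrate))
    refine ge_of_tendsto' hlim fun t => ?_
    refine le_trans (measureReal_mono fun ω hω => ?_) (measure_not_terminatedBy_le G t)
    exact fun h => hω ⟨t, h⟩
  rw [measureReal_eq_zero_iff] at hzero
  have hae : ∀ᵐ ω ∂adaptiveColouring.seeds V, ∃ t, adaptiveColouring.TerminatedBy G ω t := hzero
  filter_upwards [hae] with ω hω
  exact ⟨hω, isProper G ω⟩

/-- `192 = 3 * 64` makes the decay exponent about `3 * (Δ + log n)`: the first part absorbs the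
initial potential, the second leaves order `n⁻²` after the union bound. -/
theorem le_probWithin (G : SimpleGraph V) [DecidableRel G.Adj] :
    1 - 40000 / ((Fintype.card V : ℝ) ^ 2 + 1) ≤ adaptiveColouring.probWithin G
      (192 / rate * ((G.maxDegree : ℝ) + Real.logb 2 (Fintype.card V))) := by
  classical
  have : IsProbabilityMeasure (adaptiveColouring.seeds V) := by
    unfold Algorithm.seeds; infer_instance
  set n := Fintype.card V with hn
  rcases Nat.eq_zero_or_pos n with h0 | hpos
  · rw [h0]
    refine le_trans ?_ measureReal_nonneg
    norm_num
  have hn1 : (1 : ℝ) ≤ n := by exact_mod_cast hpos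
  set Δ := G.maxDegree with hΔ
  set x := 192 / rate * ((Δ : ℝ) + Real.logb 2 n) with hx
  have hrate : rate = 1 / 102400000000 := rfl
  have hrate0 : 0 < rate := by rw [hrate]; norm_num
  have hlogb : 0 ≤ Real.logb 2 n := Real.logb_nonneg (by norm_num) hn1
  have hx0 : 0 ≤ x := by positivity
  set t := ⌊x⌋₊ with ht
  have hfail := measure_not_terminatedBy_le G t
  have hdeg : @SimpleGraph.maxDegree V G _ (fun a b => Classical.propDecidable (G.Adj a b)) = Δ := by
    rw [hΔ]
    congr
  rw [hdeg, ← hn] at hfail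
  have hcompl : {ω | ∃ t : ℕ, (t : ℝ) ≤ x ∧ adaptiveColouring.TerminatedBy G ω t}ᶜ ⊆
      {ω | ¬ adaptiveColouring.TerminatedBy G ω t} :=
    fun ω hω h => hω ⟨t, Nat.floor_le hx0, h⟩
  have hle : 1 - (adaptiveColouring.seeds V).real {ω | ¬ adaptiveColouring.TerminatedBy G ω t} ≤
      adaptiveColouring.probWithin G x := by
    have h1 := measureReal_mono (μ := adaptiveColouring.seeds V) hcompl
    have h2 := measureReal_union_le (μ := adaptiveColouring.seeds V)
      {ω | ∃ t : ℕ, (t : ℝ) ≤ x ∧ adaptiveColouring.TerminatedBy G ω t}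
      {ω | ∃ t : ℕ, (t : ℝ) ≤ x ∧ adaptiveColouring.TerminatedBy G ω t}ᶜ
    rw [Set.union_compl_self, probReal_univ] at h2
    unfold Algorithm.probWithin
    linarith
  refine le_trans ?_ hle
  have hlog : Real.log n ≤ Real.logb 2 n := by
    rw [Real.logb, le_div_iff₀ (Real.log_pos (by norm_num))]
    have := Real.log_nonneg hn1
    nlinarith [Real.log_two_lt_d9]
  -- Rounding the time down costs at most `rate / 64 ≤ 1`, hence the 2.
  have hexp : 1 + rate * (34817 * Δ) - rate / 64 * t ≤ 2 - 3 * Real.log n := by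
    have h1 : x < t + 1 := Nat.lt_floor_add_one x
    have h2 : rate / 64 * x = 3 * ((Δ : ℝ) + Real.logb 2 n) := by
      rw [hx]
      field_simp
      ring
    have h3 : rate / 64 * x ≤ rate / 64 * (t + 1) :=
      mul_le_mul_of_nonneg_left h1.le (by positivity)
    have h4 : (0 : ℝ) ≤ Δ := Nat.cast_nonneg _
    rw [h2, mul_add] at h3
    have h5 : rate / 64 * 1 ≤ 1 := by rw [hrate]; norm_num
    have h6 : rate * (34817 * Δ) ≤ 3 * Δ := by
      rw [← mul_assoc]
      exact mul_le_mul_of_nonneg_right (by rw [hrate]; norm_num) h4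
    linarith
  have hn0 : (0 : ℝ) < n := by linarith
  have hbound : (n : ℝ) * Real.exp (2 - 3 * Real.log n) ≤ 40000 / ((n : ℝ) ^ 2 + 1) := by
    have h1 : Real.exp (2 - 3 * Real.log n) = Real.exp 1 ^ 2 / (n : ℝ) ^ 3 := by
      rw [Real.exp_sub, ← Real.exp_nat_mul, show (3 : ℝ) * Real.log n = (3 : ℕ) * Real.log n by
        norm_num, Real.exp_nat_mul, Real.exp_log hn0]
      norm_num
    have h2 : Real.exp 1 ^ 2 ≤ 9 := by
      have := Real.exp_one_lt_three
      nlinarith [Real.exp_pos 1]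
    rw [h1, mul_div_assoc', div_le_div_iff₀ (by positivity) (by positivity)]
    have h3 : (1 : ℝ) ≤ (n : ℝ) ^ 2 := one_le_pow₀ hn1
    calc (n : ℝ) * Real.exp 1 ^ 2 * ((n : ℝ) ^ 2 + 1) ≤ n * 9 * (2 * (n : ℝ) ^ 2) := by
          gcongr
          linarith
      _ = 18 * (n : ℝ) ^ 3 := by ring
      _ ≤ 40000 * (n : ℝ) ^ 3 := by gcongr; norm_num
  have := mul_le_mul_of_nonneg_left (Real.exp_le_exp.2 hexp) hn0.le
  linarith

end adaptiveColouring
end Beeping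

theorem mainTheorem4 :
    -- upper bound: some Las Vegas algorithm needs `O(Δ + log n)` slots with high probability
    (∃ A : Beeping.Algorithm, A.IsLasVegasColouring ∧
      (∀ (V : Type) [Fintype V] (G : SimpleGraph V) (ω : V → A.Seed), A.IsProper G ω) ∧
      ∃ C : ℝ, ∃ ε : ℕ → ℝ, ε =o[atTop] (fun n : ℕ => (n : ℝ)⁻¹) ∧
        ∀ (V : Type) [Fintype V] (G : SimpleGraph V) [DecidableRel G.Adj],
          1 - ε (Fintype.card V) ≤
            A.probWithin G (C * ((G.maxDegree : ℝ) + Real.logb 2 (Fintype.card V)))) ∧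
    -- lower bound: for all `n` and `Δ`, some network with `n` nodes and maximum degree `Δ`
    -- forces every Las Vegas algorithm to use `Ω(Δ + log n)` slots with high probability
    (∃ c : ℝ, 0 < c ∧ ∃ ε : ℕ → ℝ, ε =o[atTop] (fun n : ℕ => (n : ℝ)⁻¹) ∧
      ∀ n Δ : ℕ, 1 ≤ Δ → Δ < n →
        ∃ (G : SimpleGraph (Fin n)) (_ : DecidableRel G.Adj), G.maxDegree = Δ ∧
          ∀ A : Beeping.Algorithm, A.IsLasVegasColouring →
            A.probWithin G (c * ((Δ : ℝ) + Real.logb 2 n)) ≤ ε n) ∧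
    -- complete graphs: at least `n` slots, with probability one
    (∀ A : Beeping.Algorithm, (∀ m : ℕ, A.IsLasVegasColouringOn (⊤ : SimpleGraph (Fin m))) →
      ∀ n : ℕ, ∀ᵐ ω ∂(A.seeds (Fin n)),
        ∀ t : ℕ, A.TerminatedBy (⊤ : SimpleGraph (Fin n)) ω t → n ≤ t) ∧
    -- rings: `Ω(log n)` slots with high probability
    (∃ c : ℝ, 0 < c ∧ ∃ ε : ℕ → ℝ, ε =o[atTop] (fun n : ℕ => (n : ℝ)⁻¹) ∧
      ∀ (A : Beeping.Algorithm) (n : ℕ),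
        A.IsLasVegasColouringOn (SimpleGraph.cycleGraph n) →
          A.probWithin (SimpleGraph.cycleGraph n) (c * Real.logb 2 n) ≤ ε n) := by
  classical
  refine ⟨⟨Beeping.adaptiveColouring, Beeping.adaptiveColouring.isLasVegasColouring, ?_,
    192 / Beeping.adaptiveColouring.rate, _,
    Beeping.const_div_sq_isLittleO 40000, ?_⟩, ⟨1 / 16, by norm_num, _,
    Beeping.const_div_sq_isLittleO 40000, ?_⟩, ?_, ⟨1 / 8, by norm_num, _,
    Beeping.const_div_sq_isLittleO 40000, ?_⟩⟩
  · intro V _ G ω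
    exact Beeping.adaptiveColouring.isProper G ω
  · intro V _ G _
    exact Beeping.adaptiveColouring.le_probWithin G
  · intro n Δ hΔ hΔn
    exact ⟨Beeping.Algorithm.blockGraph n Δ, inferInstance,
      Beeping.Algorithm.maxDegree_blockGraph hΔ hΔn,
      fun A hA => Beeping.Algorithm.probWithin_blockGraph_le hΔn hA⟩
  · intro A hA n
    exact Beeping.Algorithm.ae_le_of_terminatedBy_top hA n
  · intro A n hA
    exact Beeping.Algorithm.probWithin_cycleGraph_le n hA
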